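/- Let $\mathcal K$ be an infinite-dimensional separable complex Hilbert space, with inner product linear in the second argument. A family $\{\varphi_j\}_{j\in\mathbb J}$ in a Hilbert space is a *Parseval frame* if $\sum_j|\langle\varphi_j,f\rangle|^2=\|f\|^2$ for all $f$. Let the index set $\mathbb J$ be a countable linearly ordered set in which every interval $[i,j]$ is finite (so it is ordered like a set of integers, e.g. like $\mathbb N$ or $\mathbb Z$), let $\{\varphi_j\}_{j\in\mathbb J}$ be a Parseval frame of $\mathcal K$, and let $\{\psi_j\}_{j\in\mathbb J}$ be a Parseval frame of a Hilbert space $\mathcal M$ that is Naimark complementary to it: $\{\varphi_j\oplus\psi_j\}_{j\in\mathbb J}$ is an orthonormal basis of $\mathcal K\oplus\mathcal M$. Let $\mathsf E=\{E_j\}_{j\in\mathbb J}$ be real numbers with $E_i<E_j$ for $i<j$. Assume that $\mathbb J$ has a least element (as for $\mathbb J=\mathbb N$), or has a greatest element, or that $\mathsf E$ is unbounded. Put $$H_{\varphi\mathsf E}=\sum_{j}E_j\langle\varphi_j,\cdot\rangle\varphi_j,\qquad \mathcal D(H_{\varphi\mathsf E})=\Big\{f\in\mathcal K:\ \sum_j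 E_j^2|\langle\varphi_j,f\rangle|^2<\infty\Big\},$$ and suppose that $H_{\varphi\mathsf E}$ is self-adjoint (in particular densely defined) and that the operator $B=\sum_jE_j\langle\varphi_j,\cdot\rangle\psi_j$ from $\mathcal K$ to $\mathcal M$ is bounded, that is, $\|Bf\|\le C\|f\|$ for some constant $C$ and all $f\in\mathcal D(H_{\varphi\mathsf E})$. Then there are an orthonormal basis $\{e'_j\}_{j\in\mathbb J}$ of $\mathcal K$ and real numbers $\mathsf E'=\{E'_j\}_{j\in\mathbb J}$ such that $$H_{\varphi\mathsf E}=\sum_jE'_j\langle e'_j,\cdot\rangle e'_j,\qquad \mathcal D(H_{\varphi\mathsf E})=\Big\{f\in\mathcal K:\ \sum_j E_j'^2|\langle e'_j,f\rangle|^2<\infty\Big\},$$ and the discrete spectrum of $H_{\varphi\mathsf E}$ (the set of isolated points of the spectrum that are eigenvalues of finite multiplicity) is the set $\{E'_j: j\in\mathbb J\}$. Moreover, if $|E_j|\to\infty$ (that is, $\{j:|E_j|\le C\}$ is finite for every $C$), then $H_{\varphi\mathsf E}$ has compact resolvent and its spectrum is $\{E'_j: j\in\mathbb J\}$. If instead $E_j\to\lambda\in\mathbb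 R$ (that is, $\{j:|E_j-\lambda|\ge\varepsilon\}$ is finite for every $\varepsilon>0$), then $\lambda I-H_{\varphi\mathsf E}$ is a compact operator defined on all of $\mathcal K$, and the spectrum of $H_{\varphi\mathsf E}$ is $\{\lambda\}\cup\{E'_j: j\in\mathbb J\}$. -/

import Mathlib

open scoped InnerProductSpace

section Frames

variable {J : Type*} {K : Type*} [NormedAddCommGroup K] [InnerProductSpace ℂ K]
  {M : Type*} [NormedAddCommGroup M] [InnerProductSpace ℂ M]

/-- A Parseval frame: `∑ j, |⟨φ j, f⟩|² = ‖f‖²` for every vector `f`.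
The inner product is linear in its second argument. -/
def IsParsevalFrame (φ : J → K) : Prop :=
  ∀ f : K, HasSum (fun j => ‖⟪φ j, f⟫_ℂ‖ ^ 2) (‖f‖ ^ 2)

/-- `ψ` (in `M`) is Naimark complementary to `φ` (in `K`): both families are Parseval frames,
and the vectors `φ j ⊕ ψ j` form an orthonormal basis of the Hilbert direct sum `K ⊕ M`. -/
structure IsNaimarkComplement (φ : J → K) (ψ : J → M) : Prop where
  parseval_left : IsParsevalFrame φ
  parseval_right : IsParsevalFrame ψ
  basis : ∃ h : HilbertBasis J ℂ (WithLp 2 (K × M)), ∀ j, h j = WithLp.toLp 2 (φ j, ψ j)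

/-- The vectors of an orthonormal basis form a Parseval frame. -/
theorem HilbertBasis.isParsevalFrame (e : HilbertBasis J ℂ K) :
    IsParsevalFrame (fun j => e j) := by
  intro f
  have h := Complex.reCLM.hasSum (e.hasSum_inner_mul_inner f f)
  have h2 : Complex.reCLM ⟪f, f⟫_ℂ = ‖f‖ ^ 2 := by
    simp [inner_self_eq_norm_sq_to_K, ← Complex.ofReal_pow]
  rw [h2] at h
  convert h using 1
  funext j
  rw [← inner_conj_symm f (e j), Complex.conj_mul', ← Complex.ofReal_pow]
  exact (Complex.ofReal_re _).symm

/-- A square-summable combination of the vectors of a Parseval frame converges unconditionally. -/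
theorem IsParsevalFrame.summable_smul [CompleteSpace M] {ψ : J → M} (hψ : IsParsevalFrame ψ)
    {c : J → ℂ} (hc : Summable fun j => ‖c j‖ ^ 2) : Summable fun j => c j • ψ j := by
  have key : ∀ s : Finset J, ‖∑ j ∈ s, c j • ψ j‖ ^ 2 ≤ ∑ j ∈ s, ‖c j‖ ^ 2 := by
    intro s
    set v := ∑ j ∈ s, c j • ψ j with hv
    have h1 : ‖v‖ ^ 2 ≤ ∑ j ∈ s, ‖c j‖ * ‖⟪ψ j, v⟫_ℂ‖ := by
      have h0 : ⟪v, v⟫_ℂ = ∑ j ∈ s, (starRingEnd ℂ) (c j) * ⟪ψ j, v⟫_ℂ := by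
        conv_lhs => rw [hv]
        rw [sum_inner]
        exact Finset.sum_congr rfl fun j _ => inner_smul_left _ _ _
      calc ‖v‖ ^ 2 = ‖⟪v, v⟫_ℂ‖ := by
            rw [inner_self_eq_norm_sq_to_K]; simp
        _ ≤ ∑ j ∈ s, ‖(starRingEnd ℂ) (c j) * ⟪ψ j, v⟫_ℂ‖ := h0 ▸ norm_sum_le _ _
        _ = _ := by simp
    have h2 : ∑ j ∈ s, ‖⟪ψ j, v⟫_ℂ‖ ^ 2 ≤ ‖v‖ ^ 2 :=
      sum_le_hasSum s (fun j _ => by positivity) (hψ v)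
    have h3 : ∑ j ∈ s, ‖c j‖ * ‖⟪ψ j, v⟫_ℂ‖
        ≤ ∑ j ∈ s, (‖c j‖ ^ 2 + ‖⟪ψ j, v⟫_ℂ‖ ^ 2) / 2 :=
      Finset.sum_le_sum fun j _ => by nlinarith [sq_nonneg (‖c j‖ - ‖⟪ψ j, v⟫_ℂ‖)]
    rw [← Finset.sum_div, Finset.sum_add_distrib] at h3
    linarith
  rw [summable_iff_vanishing_norm] at hc ⊢
  intro ε hε
  obtain ⟨s, hs⟩ := hc (ε ^ 2) (by positivity)
  refine ⟨s, fun t ht => ?_⟩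
  have h := (key t).trans_lt ((le_abs_self _).trans_lt (hs t ht))
  exact lt_of_pow_lt_pow_left₀ 2 hε.le h

/-- The subspace of all `f` with `∑ j, E j ^ 2 * |⟨φ j, f⟩|² < ∞`. -/
def minDomain (φ : J → K) (E : J → ℝ) : Submodule ℂ K where
  carrier := {f | Summable fun j => E j ^ 2 * ‖⟪φ j, f⟫_ℂ‖ ^ 2}
  zero_mem' := by simp [summable_zero]
  add_mem' := by
    intro f g hf hg
    refine Summable.of_nonneg_of_le (fun j => by positivity) (fun j => ?_)
      ((hf.add hg).mul_left 2)
    have h : ‖⟪φ j, f + g⟫_ℂ‖ ≤ ‖⟪φ j, f⟫_ℂ‖ + ‖⟪φ j, g⟫_ℂ‖ := by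
      rw [inner_add_right]; exact norm_add_le _ _
    have h' : ‖⟪φ j, f + g⟫_ℂ‖ ^ 2 ≤ 2 * (‖⟪φ j, f⟫_ℂ‖ ^ 2 + ‖⟪φ j, g⟫_ℂ‖ ^ 2) := by
      nlinarith [norm_nonneg ⟪φ j, f + g⟫_ℂ, sq_nonneg (‖⟪φ j, f⟫_ℂ‖ - ‖⟪φ j, g⟫_ℂ‖)]
    nlinarith [sq_nonneg (E j)]
  smul_mem' := by
    intro c f hf
    refine (hf.mul_left (‖c‖ ^ 2)).congr fun j => ?_
    rw [inner_smul_right, norm_mul]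
    ring

/-- The coefficients `E j * ⟨φ j, f⟩` are square-summable for `f` in the minimal domain. -/
theorem minDomain.summable_sq {φ : J → K} {E : J → ℝ} {f : K} (hf : f ∈ minDomain φ E) :
    Summable fun j => ‖(E j : ℂ) * ⟪φ j, f⟫_ℂ‖ ^ 2 := by
  refine Summable.congr hf fun j => ?_
  simp [mul_pow]

/-- The operator `∑ j, E j ⟨φ j, ·⟩ ψ j` from `K` to `M`, with domain
`{f | ∑ j, E j ^ 2 * |⟨φ j, f⟩|² < ∞}`, on which the series converges unconditionally
because `ψ` is a Parseval frame. -/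
noncomputable def frameOperator [CompleteSpace M] (φ : J → K) (E : J → ℝ) {ψ : J → M}
    (hψ : IsParsevalFrame ψ) : K →ₗ.[ℂ] M where
  domain := minDomain φ E
  toFun :=
    { toFun := fun f => ∑' j, ((E j : ℂ) * ⟪φ j, (f : K)⟫_ℂ) • ψ j
      map_add' := by
        intro f g
        rw [← (hψ.summable_smul (minDomain.summable_sq f.2)).tsum_add
          (hψ.summable_smul (minDomain.summable_sq g.2))]
        refine tsum_congr fun j => ?_
        rw [Submodule.coe_add, inner_add_right, mul_add, add_smul]
      map_smul' := by
        intro c f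
        rw [RingHom.id_apply,
          ← (hψ.summable_smul (minDomain.summable_sq f.2)).tsum_const_smul c]
        refine tsum_congr fun j => ?_
        rw [Submodule.coe_smul, inner_smul_right, smul_smul]
        congr 1
        ring }

/-- The Hamiltonian `∑ j, E j ⟨φ j, ·⟩ φ j` generated by a Parseval frame `φ` and reals `E`. -/
noncomputable def hamiltonian [CompleteSpace K] {φ : J → K} (hφ : IsParsevalFrame φ)
    (E : J → ℝ) : K →ₗ.[ℂ] K :=
  frameOperator φ E hφ

/-- A possibly unbounded linear operator is bounded (on its domain). -/
def LinearPMap.IsBounded (T : K →ₗ.[ℂ] M) : Prop :=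
  ∃ C : ℝ, ∀ f : T.domain, ‖T f‖ ≤ C * ‖(f : K)‖

/-- `R` is the resolvent `(T - z)⁻¹`: a bounded, everywhere defined two-sided inverse
of `T - z : T.domain → K`. -/
def LinearPMap.IsResolventAt (T : K →ₗ.[ℂ] K) (z : ℂ) (R : K →L[ℂ] K) : Prop :=
  (∀ g : K, ∃ h : R g ∈ T.domain, T ⟨R g, h⟩ - z • R g = g) ∧
    ∀ f : T.domain, R (T f - z • (f : K)) = f

/-- The spectrum of a possibly unbounded operator. -/
def LinearPMap.opSpectrum (T : K →ₗ.[ℂ] K) : Set ℂ :=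
  {z | ¬ ∃ R : K →L[ℂ] K, T.IsResolventAt z R}

/-- The eigenspace `ker (T - z)`. -/
def LinearPMap.eigenspaceAt (T : K →ₗ.[ℂ] K) (z : ℂ) : Submodule ℂ K where
  carrier := {f | ∃ h : f ∈ T.domain, T ⟨f, h⟩ = z • f}
  zero_mem' := ⟨T.domain.zero_mem, by
    rw [smul_zero]; exact T.map_zero⟩
  add_mem' := by
    rintro f g ⟨hf, hf'⟩ ⟨hg, hg'⟩
    refine ⟨T.domain.add_mem hf hg, ?_⟩
    have h := T.map_add ⟨f, hf⟩ ⟨g, hg⟩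
    rw [hf', hg', ← smul_add] at h
    exact h
  smul_mem' := by
    rintro c f ⟨hf, hf'⟩
    refine ⟨T.domain.smul_mem c hf, ?_⟩
    have h := T.map_smul c ⟨f, hf⟩
    rw [hf', smul_comm] at h
    exact h

/-- The discrete spectrum of a self-adjoint operator: the isolated points of the spectrum
that are eigenvalues of finite (positive) multiplicity. -/
def LinearPMap.discreteSpectrum (T : K →ₗ.[ℂ] K) : Set ℂ :=
  {z | z ∈ T.opSpectrum ∧ (∃ ε > 0, ∀ w ∈ T.opSpectrum, dist w z < ε → w = z) ∧
    T.eigenspaceAt z ≠ ⊥ ∧ FiniteDimensional ℂ (T.eigenspaceAt z)}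

/-- The resolvent set is non-empty and all resolvents are compact operators. -/
def LinearPMap.HasCompactResolvent (T : K →ₗ.[ℂ] K) : Prop :=
  (∃ z R, T.IsResolventAt z R) ∧ ∀ z R, T.IsResolventAt z R → IsCompactOperator R

end Frames

/-! Since the vectors `φ j ⊕ ψ j` are orthonormal, ‖Hf‖² + ‖Bf‖² = ∑ E_j² |⟨φ_j, f⟩|² on the domain
of H. If B is bounded and R is the resolvent at a nonreal z, the functionals c_j = (E_j - z)⟨φ_j, R
·⟩ therefore form a Bessel family. A series ∑ η_j conj⟨φ_j, R a⟩ ⟨φ_j, R b⟩ is diagonal in this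
family with coefficients η_j / |E_j - z|², and it defines a compact operator as soon as these tend
to zero (`isCompactOperator_of_hasSum_inner`).

Take z = l + i with l real. Then R + R* = 2(H - l)((H - l)² + 1)⁻¹ has such a series with η_j =
2(E_j - l), so it is compact when the energies accumulate only at l and at infinity. It is injective
when l is not an eigenvalue. Such an l exists: by `StrictMono.exists_center` either |E_j| → ∞, and
any l outside the countable set of eigenvalues will do, or l can be chosen strictly on one side of
all energies, where the form of H - l is definite.

The spectral theorem now splits the space into finite-dimensional eigenspaces of R + R*. The
symmetric operator -i(R - R*) commutes with R + R* and is diagonalized inside each of them. Joint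
eigenvectors are eigenvectors of R, hence of H, and they give the basis. The spectral statements are
then read off from the diagonal form of H. -/

/-! ### Compact operators given by diagonal series -/

section CompactSeries

open Filter Topology ComplexConjugate

variable {J : Type*} {K : Type*} [NormedAddCommGroup K] [InnerProductSpace ℂ K] [CompleteSpace K]

/-- An operator given by a diagonal quadratic series with null coefficients is compact. -/
theorem isCompactOperator_of_hasSum_inner {S : K →L[ℂ] K} {c : J → K →L[ℂ] ℂ} {θ : J → ℂ}
    {C : ℝ} (hC : 0 ≤ C) (hc : ∀ (a : K) (s : Finset J), ∑ j ∈ s, ‖c j a‖ ^ 2 ≤ C * ‖a‖ ^ 2)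
    (hθ : Tendsto θ cofinite (𝓝 0))
    (hS : ∀ a b : K, HasSum (fun j => θ j * (conj (c j a) * c j b)) ⟪a, S b⟫_ℂ) :
    IsCompactOperator S := by
  classical
  -- Riesz representatives turn the partial sums of the form into finite-rank operators `T F`; it
  -- remains to show that they converge in norm.
  let y : J → K := fun j => (InnerProductSpace.toDual ℂ K).symm (c j)
  have hy : ∀ j a, ⟪y j, a⟫_ℂ = c j a := fun j a => InnerProductSpace.toDual_symm_apply
  let T : Finset J → K →L[ℂ] K := fun F => ∑ j ∈ F, θ j • (c j).smulRight (y j)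
  have hT : ∀ F a b, ⟪a, T F b⟫_ℂ = ∑ j ∈ F, θ j * (conj (c j a) * c j b) := by
    intro F a b
    simp only [T, sum_apply, inner_sum]
    refine Finset.sum_congr rfl fun j _ => ?_
    simp only [smul_apply, ContinuousLinearMap.smulRight_apply,
      inner_smul_right]
    rw [← inner_conj_symm a (y j), hy]
    ring
  have hTc : ∀ F, IsCompactOperator (T F) := by
    intro F
    change T F ∈ compactOperator (RingHom.id ℂ) K K
    refine Submodule.sum_mem _ fun j _ => Submodule.smul_mem _ _ ?_
    exact (isCompactOperator_of_locallyCompactSpace_dom (c j)).clm_comp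
      ((1 : ℂ →L[ℂ] ℂ).smulRight (y j))
  have hCS : ∀ (a b : K) (s : Finset J),
      ∑ j ∈ s, ‖c j a‖ * ‖c j b‖ ≤ C * (‖a‖ * ‖b‖) := by
    intro a b s
    have h := Finset.sum_mul_sq_le_sq_mul_sq s (fun j => ‖c j a‖) (fun j => ‖c j b‖)
    refine le_of_sq_le_sq ?_ (by positivity)
    calc _ ≤ _ := h
      _ ≤ (C * ‖a‖ ^ 2) * (C * ‖b‖ ^ 2) :=
          mul_le_mul (hc a s) (hc b s) (by positivity) (by positivity)
      _ = _ := by ring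
  refine isCompactOperator_of_tendsto (l := atTop) (F := T) ?_ (Eventually.of_forall hTc)
  rw [Metric.tendsto_atTop]
  intro ε hε
  -- This gives `δ * C < ε`, also when `C = 0`.
  set δ := ε / (2 * (C + 1)) with hδ
  have hδ0 : 0 < δ := by positivity
  have hfin : {j | ¬ ‖θ j‖ < δ}.Finite := by
    have := hθ (Metric.ball_mem_nhds 0 hδ0)
    simpa [Filter.mem_map, Filter.mem_cofinite, Set.compl_def] using this
  refine ⟨hfin.toFinset, fun F hF => ?_⟩
  rw [dist_comm, dist_eq_norm]
  have hsmall : ∀ j ∉ F, ‖θ j‖ ≤ δ := by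
    intro j hj
    by_contra h
    exact hj (hF (hfin.mem_toFinset.2 fun h' => h h'.le))
  have key : ∀ a b, ‖⟪a, (S - T F) b⟫_ℂ‖ ≤ δ * (C * (‖a‖ * ‖b‖)) := by
    intro a b
    have hlim : Tendsto (fun s : Finset J => ∑ j ∈ s, θ j * (conj (c j a) * c j b)
        - ∑ j ∈ F, θ j * (conj (c j a) * c j b)) atTop (𝓝 ⟪a, (S - T F) b⟫_ℂ) := by
      rw [sub_apply, inner_sub_right, hT]
      exact (hS a b).sub_const _
    refine le_of_tendsto hlim.norm ?_
    filter_upwards [eventually_ge_atTop F] with s hs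
    rw [← Finset.sum_sdiff hs, add_sub_cancel_right]
    refine (norm_sum_le _ _).trans ?_
    calc _ ≤ ∑ j ∈ s \ F, δ * (‖c j a‖ * ‖c j b‖) := by
          refine Finset.sum_le_sum fun j hj => ?_
          rw [norm_mul, norm_mul, RCLike.norm_conj]
          exact mul_le_mul_of_nonneg_right (hsmall j (Finset.mem_sdiff.1 hj).2) (by positivity)
      _ ≤ _ := by
          rw [← Finset.mul_sum]
          exact mul_le_mul_of_nonneg_left (hCS a b _) hδ0.le
  refine lt_of_le_of_lt (ContinuousLinearMap.opNorm_le_bound _ (M := δ * C) (by positivity)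
    fun b => ?_) (b := δ * C) ?_
  · rcases eq_or_ne ((S - T F) b) 0 with h0 | h0
    · rw [h0, norm_zero]; positivity
    -- Testing the weak estimate against `a = (S - T F) b` bounds the norm of that vector.
    · have h := key ((S - T F) b) b
      have h1 : 0 < ‖(S - T F) b‖ := norm_pos_iff.2 h0
      rw [inner_self_eq_norm_sq_to_K] at h
      simp only [Complex.coe_algebraMap, norm_pow, Complex.norm_real, norm_norm] at h
      refine le_of_mul_le_mul_left ?_ h1
      nlinarith
  · rw [hδ, div_mul_eq_mul_div, div_lt_iff₀ (by positivity)]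
    nlinarith

omit [CompleteSpace K] in
/-- A compact operator maps an orthonormal family to a null family. -/
theorem IsCompactOperator.tendsto_orthonormal_eigenvalues {S : K →L[ℂ] K} (hS : IsCompactOperator S)
    {e : J → K} (he : Orthonormal ℂ e) {s : J → ℂ} (hs : ∀ j, S (e j) = s j • e j) :
    Tendsto s cofinite (𝓝 0) := by
  rw [Metric.tendsto_nhds]
  intro ε hε
  rw [Filter.eventually_cofinite]
  by_contra hinf
  have hcpt := hS.isCompact_closure_image_closedBall (f := (S : K →ₗ[ℂ] K)) 1
  have htb := hcpt.totallyBounded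
  obtain ⟨t, ht, hcov⟩ := Metric.totallyBounded_iff.1 htb (ε / 2) (by positivity)
  have hmem : ∀ j, ∃ x ∈ t, dist (S (e j)) x < ε / 2 := by
    intro j
    have := hcov (subset_closure (Set.mem_image_of_mem _
      (show e j ∈ Metric.closedBall (0 : K) 1 by simp [he.1 j])))
    simpa using this
  choose x hx hd using hmem
  -- Infinitely many indices share finitely many centres, so two distinct images lie within `ε`.
  -- They are orthogonal of norm at least `ε`, which contradicts Pythagoras.
  obtain ⟨i, hi, j, hj, hij, hxy⟩ := Set.Infinite.exists_ne_map_eq_of_mapsTo hinf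
    (f := x) (fun j _ => hx j) ht
  have h1 : dist (S (e i)) (S (e j)) < ε := by
    have := dist_triangle_right (S (e i)) (S (e j)) (x i)
    have h2 := hd i
    have h3 := hd j
    rw [← hxy] at h3
    linarith
  have h2 : ‖S (e i) - S (e j)‖ ^ 2 = ‖s i‖ ^ 2 + ‖s j‖ ^ 2 := by
    rw [hs, hs, @norm_sub_sq ℂ, inner_smul_left, inner_smul_right, he.2 hij]
    simp [norm_smul, he.1]
  have h3 : ε ≤ ‖s i‖ := by simpa using hi
  rw [dist_eq_norm] at h1
  nlinarith [norm_nonneg (S (e i) - S (e j)), sq_nonneg ‖s j‖]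

end CompactSeries

/-! ### Series expansions in the frame -/

section FrameSeries

open Filter Topology ComplexConjugate

variable {J : Type*} {K : Type*} [NormedAddCommGroup K] [InnerProductSpace ℂ K]
  {M : Type*} [NormedAddCommGroup M] [InnerProductSpace ℂ M]

theorem IsParsevalFrame.eq_zero {φ : J → K} (hφ : IsParsevalFrame φ) {f : K}
    (hf : ∀ j, ⟪φ j, f⟫_ℂ = 0) : f = 0 := by
  have h := (hφ f).unique (a₂ := 0) (by simp [hf, hasSum_zero])
  simpa using h

theorem IsNaimarkComplement.hasSum_inner {φ : J → K} {ψ : J → M} (h : IsNaimarkComplement φ ψ)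
    (a b : K) : HasSum (fun j => conj ⟪φ j, a⟫_ℂ * ⟪φ j, b⟫_ℂ) ⟪a, b⟫_ℂ := by
  obtain ⟨e, he⟩ := h.basis
  have h1 := e.hasSum_inner_mul_inner (WithLp.toLp 2 (a, 0)) (WithLp.toLp 2 (b, 0))
  simpa [he, WithLp.prod_inner_apply] using h1

theorem inner_frameOperator_hasSum [CompleteSpace M] (φ : J → K) (E : J → ℝ) {ψ : J → M}
    (hψ : IsParsevalFrame ψ) (g : M) (f : (frameOperator φ E hψ).domain) :
    HasSum (fun j => (E j : ℂ) * (conj ⟪ψ j, g⟫_ℂ * ⟪φ j, (f : K)⟫_ℂ))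
      ⟪g, frameOperator φ E hψ f⟫_ℂ := by
  have h := (hψ.summable_smul (minDomain.summable_sq f.2)).hasSum
  have h2 := h.mapL (innerSL ℂ g)
  refine (congrArg (HasSum · _) (funext fun j => ?_)).mpr h2
  rw [innerSL_apply_apply, inner_smul_right, inner_conj_symm]
  ring

/-- The graph norms of the Hamiltonian and of the off-diagonal operator add up to the weighted
norm of the frame coefficients. -/
theorem IsNaimarkComplement.hasSum_norm_sq [CompleteSpace K] [CompleteSpace M]
    {φ : J → K} {ψ : J → M} (h : IsNaimarkComplement φ ψ) (E : J → ℝ) {f : K}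
    (hf : f ∈ minDomain φ E) :
    HasSum (fun j => E j ^ 2 * ‖⟪φ j, f⟫_ℂ‖ ^ 2)
      (‖hamiltonian h.parseval_left E ⟨f, hf⟩‖ ^ 2
        + ‖frameOperator φ E h.parseval_right ⟨f, hf⟩‖ ^ 2) := by
  obtain ⟨e, he⟩ := h.basis
  have hs := minDomain.summable_sq hf
  have hx := (e.isParsevalFrame.summable_smul hs).hasSum
  -- The components of `x` in `K` and `M` are the two operators applied to `f`, so the claim is
  -- Parseval's identity for `x`.
  set x := ∑' j, ((E j : ℂ) * ⟪φ j, f⟫_ℂ) • e j with hxdef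
  have h1 : x.fst = hamiltonian h.parseval_left E ⟨f, hf⟩ := by
    have := hx.mapL (WithLp.fstL 2 ℂ K M)
    simp only [he] at this
    exact this.unique (h.parseval_left.summable_smul hs).hasSum
  have h2 : x.snd = frameOperator φ E h.parseval_right ⟨f, hf⟩ := by
    have := hx.mapL (WithLp.sndL 2 ℂ K M)
    simp only [he] at this
    exact this.unique (h.parseval_right.summable_smul hs).hasSum
  have h3 : ∀ j, ⟪e j, x⟫_ℂ = (E j : ℂ) * ⟪φ j, f⟫_ℂ := by
    intro j
    have h4 := hx.mapL (innerSL ℂ (e j))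
    have h5 : HasSum (fun i => innerSL ℂ (e j) (((E i : ℂ) * ⟪φ i, f⟫_ℂ) • e i))
        (innerSL ℂ (e j) (((E j : ℂ) * ⟪φ j, f⟫_ℂ) • e j)) := by
      refine hasSum_single j fun i hi => ?_
      simp [e.orthonormal.2 hi.symm]
    have h6 := h4.unique h5
    simpa [inner_smul_right, e.orthonormal.1 j] using h6
  have h7 := e.isParsevalFrame x
  rw [WithLp.prod_norm_sq_eq_of_L2, h1, h2] at h7
  convert h7 using 1
  funext j
  rw [h3, norm_mul, mul_pow, Complex.norm_real, Real.norm_eq_abs, sq_abs]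

end FrameSeries

/-! ### Resolvents of unbounded self-adjoint operators -/

section Resolvent

open Filter Topology ComplexConjugate

variable {K : Type*} [NormedAddCommGroup K] [InnerProductSpace ℂ K] {T : K →ₗ.[ℂ] K}

/-- The first resolvent identity. -/
theorem LinearPMap.IsResolventAt.apply_eq {z w : ℂ} {R R' : K →L[ℂ] K}
    (hR : T.IsResolventAt z R) (hR' : T.IsResolventAt w R') (g : K) :
    R' g = R g + (w - z) • R (R' g) := by
  obtain ⟨h, h'⟩ := hR'.1 g
  have h2 := hR.2 ⟨R' g, h⟩
  rw [sub_eq_iff_eq_add] at h'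
  rw [h'] at h2
  simp only at h2
  rw [add_sub_assoc, ← sub_smul, R.map_add, R.map_smul] at h2
  exact h2.symm

theorem LinearPMap.IsResolventAt.comm {z w : ℂ} (hzw : z ≠ w) {R R' : K →L[ℂ] K}
    (hR : T.IsResolventAt z R) (hR' : T.IsResolventAt w R') (g : K) :
    R (R' g) = R' (R g) := by
  have h1 := hR.apply_eq hR' g
  have h2 := hR'.apply_eq hR g
  have h3 : (w - z) • (R (R' g) - R' (R g)) = 0 := by
    have h4 : (w - z) • R (R' g) = R' g - R g := by
      rw [eq_sub_iff_add_eq, add_comm]; exact h1.symm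
    have h5 : (z - w) • R' (R g) = R g - R' g := by
      rw [eq_sub_iff_add_eq, add_comm]; exact h2.symm
    rw [smul_sub, h4, ← neg_sub z w, neg_smul, h5]
    abel
  exact sub_eq_zero.1 ((smul_eq_zero.1 h3).resolve_left (sub_ne_zero.2 hzw.symm))

theorem LinearPMap.IsResolventAt.injective {z : ℂ} {R : K →L[ℂ] K} (hR : T.IsResolventAt z R)
    {g : K} (hg : R g = 0) : g = 0 := by
  obtain ⟨h, h'⟩ := hR.1 g
  have h0 : (⟨R g, h⟩ : T.domain) = 0 := Subtype.ext hg
  rw [h0, T.map_zero, hg, smul_zero, sub_zero] at h'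
  exact h'.symm

/-- An eigenvector of a resolvent is an eigenvector of the operator. -/
theorem LinearPMap.IsResolventAt.mem_eigenspaceAt {z ρ : ℂ} {R : K →L[ℂ] K}
    (hR : T.IsResolventAt z R) {v : K} (hρ : ρ ≠ 0) (hv : R v = ρ • v) :
    v ∈ T.eigenspaceAt (z + ρ⁻¹) := by
  obtain ⟨h, h'⟩ := hR.1 v
  have hv' : v = ρ⁻¹ • R v := by rw [hv, smul_smul, inv_mul_cancel₀ hρ, one_smul]
  have h1 : R v ∈ T.eigenspaceAt (z + ρ⁻¹) := by
    refine ⟨h, ?_⟩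
    rw [sub_eq_iff_eq_add] at h'
    rw [h', add_smul, ← hv', add_comm]
  rw [hv']
  exact Submodule.smul_mem _ _ h1

theorem LinearPMap.IsResolventAt.apply_eigenvector {z μ : ℂ} {R : K →L[ℂ] K}
    (hR : T.IsResolventAt z R) {v : K} (hv : v ∈ T.eigenspaceAt μ) (hz : μ ≠ z) :
    R v = (μ - z)⁻¹ • v := by
  obtain ⟨h, h'⟩ := hv
  have h1 := hR.2 ⟨v, h⟩
  rw [h'] at h1
  simp only at h1
  rw [← sub_smul, R.map_smul] at h1
  rw [eq_inv_smul_iff₀ (sub_ne_zero.2 hz), h1]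

theorem LinearPMap.mem_opSpectrum_of_eigenvector {μ : ℂ} {v : K} (hv : v ∈ T.eigenspaceAt μ)
    (hv0 : v ≠ 0) : μ ∈ T.opSpectrum := by
  rintro ⟨R, hR⟩
  obtain ⟨h, h'⟩ := hv
  have h1 := hR.2 ⟨v, h⟩
  rw [h', sub_self, R.map_zero] at h1
  exact hv0 h1.symm

/-- One compact resolvent makes all resolvents compact. -/
theorem LinearPMap.IsResolventAt.hasCompactResolvent {z : ℂ} {R : K →L[ℂ] K}
    (hR : T.IsResolventAt z R) (hc : IsCompactOperator R) : T.HasCompactResolvent := by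
  refine ⟨⟨z, R, hR⟩, fun w R' hR' => ?_⟩
  have h : R' = R + (w - z) • (R ∘L R') := by
    ext g
    exact hR.apply_eq hR' g
  rw [h]
  exact hc.add ((hc.comp_clm R').smul (w - z))

variable [CompleteSpace K]

theorem IsSelfAdjoint.inner_apply_left (hT : IsSelfAdjoint T) (f g : T.domain) :
    ⟪T f, (g : K)⟫_ℂ = ⟪(f : K), T g⟫_ℂ := by
  have h := LinearPMap.adjoint_isFormalAdjoint hT.dense_domain
  rw [LinearPMap.isSelfAdjoint_def.1 hT] at h
  exact h f g

theorem IsSelfAdjoint.exists_mem_domain (hT : IsSelfAdjoint T) {f w : K}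
    (h : ∀ x : T.domain, ⟪w, (x : K)⟫_ℂ = ⟪f, T x⟫_ℂ) :
    ∃ hf : f ∈ T.domain, T ⟨f, hf⟩ = w := by
  have h1 : ∃ hf : f ∈ T.adjoint.domain, T.adjoint ⟨f, hf⟩ = w :=
    ⟨LinearPMap.mem_adjoint_domain_of_exists f ⟨w, h⟩,
      LinearPMap.adjoint_apply_eq hT.dense_domain _ h⟩
  rwa [LinearPMap.isSelfAdjoint_def.1 hT] at h1

theorem IsSelfAdjoint.im_inner_self (hT : IsSelfAdjoint T) (f : T.domain) :
    (⟪(f : K), T f⟫_ℂ).im = 0 := by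
  have h := hT.inner_apply_left f f
  rw [← inner_conj_symm] at h
  exact Complex.conj_eq_iff_im.1 h

/-- As ⟨f, T f⟩ is real, the imaginary part of ⟨f, (T - z) f⟩ comes from `z` alone; Cauchy–Schwarz
then applies. -/
theorem IsSelfAdjoint.norm_sub_smul_ge (hT : IsSelfAdjoint T) (z : ℂ) (f : T.domain) :
    |z.im| * ‖(f : K)‖ ≤ ‖T f - z • (f : K)‖ := by
  have h1 : (⟪(f : K), T f - z • (f : K)⟫_ℂ).im = - (z.im * ‖(f : K)‖ ^ 2) := by
    rw [inner_sub_right, inner_smul_right, inner_self_eq_norm_sq_to_K, Complex.sub_im,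
      hT.im_inner_self]
    simp [← Complex.ofReal_pow]
  have h2 := (Complex.abs_im_le_norm _).trans (norm_inner_le_norm (𝕜 := ℂ) (f : K)
    (T f - z • (f : K)))
  rw [h1, abs_neg, abs_mul, abs_of_nonneg (sq_nonneg ‖(f : K)‖)] at h2
  rcases (norm_nonneg (f : K)).eq_or_lt with h0 | h0
  · rw [← h0, mul_zero]; exact norm_nonneg _
  · refine le_of_mul_le_mul_left ?_ h0
    linarith

theorem IsSelfAdjoint.im_eq_zero_of_mem_eigenspaceAt (hT : IsSelfAdjoint T) {z : ℂ} {v : K}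
    (hv : v ∈ T.eigenspaceAt z) (hv0 : v ≠ 0) : z.im = 0 := by
  obtain ⟨h, h'⟩ := hv
  have h1 := hT.norm_sub_smul_ge z ⟨v, h⟩
  rw [h', sub_self, norm_zero] at h1
  have h2 := norm_pos_iff.2 hv0
  simp only at h1
  exact abs_eq_zero.1 (le_antisymm (by nlinarith) (abs_nonneg _))

theorem IsSelfAdjoint.inner_eq_zero_of_mem_eigenspaceAt (hT : IsSelfAdjoint T) {μ ν : ℝ}
    (hμν : μ ≠ ν) {u v : K} (hu : u ∈ T.eigenspaceAt μ) (hv : v ∈ T.eigenspaceAt ν) :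
    ⟪u, v⟫_ℂ = 0 := by
  obtain ⟨hu, hu'⟩ := hu
  obtain ⟨hv, hv'⟩ := hv
  have h := hT.inner_apply_left ⟨u, hu⟩ ⟨v, hv⟩
  rw [hu', hv', inner_smul_left, inner_smul_right, Complex.conj_ofReal] at h
  have h2 : ((μ : ℂ) - ν) * ⟪u, v⟫_ℂ = 0 := by rw [sub_mul, sub_eq_zero]; exact h
  refine (mul_eq_zero.1 h2).resolve_left ?_
  exact sub_ne_zero.2 (Complex.ofReal_injective.ne hμν)

/-- If `T - z` is bounded below and `T - conj z` is injective, then `T` has a resolvent at `z`. -/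
theorem IsSelfAdjoint.exists_isResolventAt_of_bound (hT : IsSelfAdjoint T) {z : ℂ} {δ : ℝ}
    (hδ : 0 < δ) (hz : ∀ f : T.domain, δ * ‖(f : K)‖ ≤ ‖T f - z • (f : K)‖)
    (hker : ∀ g ∈ T.eigenspaceAt (conj z), g = 0) : ∃ R : K →L[ℂ] K, T.IsResolventAt z R := by
  let L : T.domain →ₗ[ℂ] K := T.toFun - z • T.domain.subtype
  have hL : ∀ f, L f = T f - z • (f : K) := fun f => rfl
  have hbd : ∀ f : T.domain, ‖(f : K)‖ ≤ δ⁻¹ * ‖L f‖ := by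
    intro f
    rw [inv_mul_eq_div, le_div_iff₀ hδ, mul_comm]
    exact hz f
  have hinj : Function.Injective L := by
    rw [injective_iff_map_eq_zero]
    intro f hf
    have := hbd f
    rw [hf, norm_zero, mul_zero] at this
    exact Subtype.ext (norm_le_zero_iff.1 this)
  -- The graph of a self-adjoint operator is complete, and `T - z` is bounded below on it in the
  -- graph norm, so its range is closed.
  have hclosed : IsClosed (LinearMap.range L : Set K) := by
    have hG : IsClosed (T.graph : Set (K × K)) := hT.isClosed
    have : CompleteSpace T.graph := hG.completeSpace_coe
    let Λ : T.graph →L[ℂ] K :=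
      (ContinuousLinearMap.snd ℂ K K - z • ContinuousLinearMap.fst ℂ K K) ∘L T.graph.subtypeL
    have hΛ : ∀ x : T.graph, ∃ f : T.domain, (x : K × K) = ((f : K), T f) ∧ Λ x = L f := by
      rintro ⟨⟨a, b⟩, hx⟩
      obtain ⟨f, rfl, rfl⟩ := (LinearPMap.mem_graph_iff T).1 hx
      exact ⟨f, rfl, rfl⟩
    -- The constant dominates both ‖f‖ ≤ δ⁻¹‖Lf‖ and ‖Tf‖ ≤ ‖Lf‖ + ‖z‖‖f‖.
    have hanti : AntilipschitzWith (1 + (1 + ‖z‖₊) * δ.toNNReal⁻¹) Λ := by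
      refine ContinuousLinearMap.antilipschitz_of_bound Λ fun x => ?_
      obtain ⟨f, hx, hf⟩ := hΛ x
      have hnx : ‖x‖ = max ‖(f : K)‖ ‖T f‖ :=
        (congrArg (fun p : K × K => ‖p‖) hx).trans (Prod.norm_def _)
      rw [hf, hnx]
      push_cast
      rw [Real.coe_toNNReal δ hδ.le]
      have h1 := hbd f
      have h2 : ‖T f‖ ≤ ‖L f‖ + ‖z‖ * ‖(f : K)‖ := by
        rw [hL, ← norm_smul]
        have := norm_add_le (T f - z • (f : K)) (z • (f : K))
        rwa [sub_add_cancel] at this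
      have h3 : ‖z‖ * ‖(f : K)‖ ≤ ‖z‖ * (δ⁻¹ * ‖L f‖) :=
        mul_le_mul_of_nonneg_left h1 (norm_nonneg z)
      have h4 : 0 ≤ ‖z‖ * (δ⁻¹ * ‖L f‖) := by positivity
      have h5 : 0 ≤ δ⁻¹ * ‖L f‖ := by positivity
      refine max_le ?_ ?_ <;> nlinarith [norm_nonneg (L f)]
    have hr : (LinearMap.range L : Set K) = Set.range Λ := by
      ext y
      constructor
      · rintro ⟨f, rfl⟩
        exact ⟨⟨((f : K), T f), LinearPMap.mem_graph T f⟩, rfl⟩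
      · rintro ⟨x, rfl⟩
        obtain ⟨f, -, hf⟩ := hΛ x
        exact ⟨f, hf.symm⟩
    rw [hr]
    exact hanti.isClosed_range Λ.uniformContinuous
  -- The orthogonal complement of the range lies in the kernel of `T - conj z`, which is trivial by
  -- `hker`.
  have hsurj : LinearMap.range L = ⊤ := by
    have : CompleteSpace (LinearMap.range L) := hclosed.completeSpace_coe
    rw [← Submodule.orthogonal_eq_bot_iff, Submodule.eq_bot_iff]
    intro g hg
    have h1 : ∀ f : T.domain, ⟪conj z • g, (f : K)⟫_ℂ = ⟪g, T f⟫_ℂ := by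
      intro f
      have := (Submodule.mem_orthogonal' _ _).1 hg (L f) ⟨f, rfl⟩
      rw [hL, inner_sub_right, sub_eq_zero, inner_smul_right] at this
      rw [inner_smul_left, Complex.conj_conj, this]
    obtain ⟨hg1, hg2⟩ := hT.exists_mem_domain h1
    exact hker g ⟨hg1, hg2⟩
  let e := LinearEquiv.ofBijective L ⟨hinj, LinearMap.range_eq_top.1 hsurj⟩
  have he : ∀ g, L (e.symm g) = g := fun g => e.apply_symm_apply g
  let R : K →L[ℂ] K := (T.domain.subtype ∘ₗ e.symm.toLinearMap).mkContinuous δ⁻¹ fun g => by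
    have := hbd (e.symm g)
    rwa [he] at this
  refine ⟨R, fun g => ⟨(e.symm g).2, he g⟩, fun f => ?_⟩
  exact congrArg Subtype.val (e.symm_apply_apply f)

/-- A self-adjoint operator has a resolvent at every nonreal point. -/
theorem IsSelfAdjoint.exists_isResolventAt (hT : IsSelfAdjoint T) {z : ℂ} (hz : z.im ≠ 0) :
    ∃ R : K →L[ℂ] K, T.IsResolventAt z R := by
  refine hT.exists_isResolventAt_of_bound (abs_pos.2 hz) (hT.norm_sub_smul_ge z) fun g hg => ?_
  by_contra h0
  have := hT.im_eq_zero_of_mem_eigenspaceAt hg h0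
  exact hz (by simpa using this)

theorem IsSelfAdjoint.inner_resolvent (hT : IsSelfAdjoint T) {z : ℂ} {R R' : K →L[ℂ] K}
    (hR : T.IsResolventAt z R) (hR' : T.IsResolventAt (conj z) R') (a b : K) :
    ⟪R' a, b⟫_ℂ = ⟪a, R b⟫_ℂ := by
  obtain ⟨h1, h1'⟩ := hR.1 b
  obtain ⟨h2, h2'⟩ := hR'.1 a
  conv_lhs => rw [← h1']
  conv_rhs => rw [← h2']
  rw [inner_sub_right, inner_sub_left, inner_smul_left, inner_smul_right, Complex.conj_conj,
    ← hT.inner_apply_left ⟨R' a, h2⟩ ⟨R b, h1⟩]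

end Resolvent

/-! ### Compactness from boundedness of the off-diagonal operator -/

section Compactness

open Filter Topology ComplexConjugate

variable {J : Type*} {K : Type*} [NormedAddCommGroup K] [InnerProductSpace ℂ K] [CompleteSpace K]
  {M : Type*} [NormedAddCommGroup M] [InnerProductSpace ℂ M] [CompleteSpace M]
  {φ : J → K} {ψ : J → M} {E : J → ℝ}

omit [CompleteSpace M] in
theorem IsNaimarkComplement.hasSum_inner_sub (h : IsNaimarkComplement φ ψ) (w : ℂ) (g : K)
    (f : (hamiltonian h.parseval_left E).domain) :
    HasSum (fun j => ((E j : ℂ) - w) * (conj ⟪φ j, g⟫_ℂ * ⟪φ j, (f : K)⟫_ℂ))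
      ⟪g, hamiltonian h.parseval_left E f - w • (f : K)⟫_ℂ := by
  rw [inner_sub_right, inner_smul_right]
  refine (congrArg (HasSum · _) (funext fun j => sub_mul _ _ _)).mpr ?_
  exact (inner_frameOperator_hasSum φ E h.parseval_left g f).sub ((h.hasSum_inner g f).mul_left w)

/-- If the off-diagonal operator is bounded, then the weighted frame coefficients of the vectors
in the range of a resolvent satisfy a Bessel bound. -/
theorem IsNaimarkComplement.exists_bessel_bound (h : IsNaimarkComplement φ ψ)
    (hB : (frameOperator φ E h.parseval_right).IsBounded) {z : ℂ} {R : K →L[ℂ] K}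
    (hR : (hamiltonian h.parseval_left E).IsResolventAt z R) :
    ∃ C : ℝ, 0 ≤ C ∧ ∀ (a : K) (s : Finset J),
      ∑ j ∈ s, ‖((E j : ℂ) - z) * ⟪φ j, R a⟫_ℂ‖ ^ 2 ≤ C * ‖a‖ ^ 2 := by
  obtain ⟨C, hC⟩ := hB
  -- The three squares bound ‖HRa‖², ‖BRa‖² and ‖z‖²‖Ra‖², where HRa = a + zRa; the factor 2 comes
  -- from |E_j - z|² ≤ 2E_j² + 2|z|².
  refine ⟨2 * (((1 + ‖z‖ * ‖R‖) ^ 2 + (|C| * ‖R‖) ^ 2) + ‖z‖ ^ 2 * ‖R‖ ^ 2), by positivity,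
    fun a s => ?_⟩
  obtain ⟨hf, hf'⟩ := hR.1 a
  have hRa : ‖R a‖ ≤ ‖R‖ * ‖a‖ := R.le_opNorm a
  have h1 : ‖hamiltonian h.parseval_left E ⟨R a, hf⟩‖ ≤ (1 + ‖z‖ * ‖R‖) * ‖a‖ := by
    rw [sub_eq_iff_eq_add] at hf'
    rw [hf']
    refine (norm_add_le _ _).trans ?_
    rw [norm_smul]
    nlinarith [mul_le_mul_of_nonneg_left hRa (norm_nonneg z)]
  have h2 : ‖frameOperator φ E h.parseval_right ⟨R a, hf⟩‖ ≤ |C| * ‖R‖ * ‖a‖ := by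
    refine (hC ⟨R a, hf⟩).trans ?_
    rw [mul_assoc]
    exact mul_le_mul (le_abs_self C) hRa (norm_nonneg _) (abs_nonneg C)
  have h3 := sum_le_hasSum s (fun j _ => by positivity) (h.hasSum_norm_sq E hf)
  have h4 := sum_le_hasSum s (fun j _ => by positivity) (h.parseval_left (R a))
  have h5 : ∀ j, ‖((E j : ℂ) - z) * ⟪φ j, R a⟫_ℂ‖ ^ 2
      ≤ 2 * (E j ^ 2 * ‖⟪φ j, R a⟫_ℂ‖ ^ 2) + 2 * (‖z‖ ^ 2 * ‖⟪φ j, R a⟫_ℂ‖ ^ 2) := by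
    intro j
    have h6 : ‖(E j : ℂ) - z‖ ≤ |E j| + ‖z‖ := by
      simpa using norm_sub_le (E j : ℂ) z
    have h7 : ‖(E j : ℂ) - z‖ ^ 2 ≤ 2 * E j ^ 2 + 2 * ‖z‖ ^ 2 := by
      nlinarith [sq_abs (E j), sq_nonneg (|E j| - ‖z‖), norm_nonneg ((E j : ℂ) - z)]
    rw [norm_mul, mul_pow]
    nlinarith [sq_nonneg ‖⟪φ j, R a⟫_ℂ‖]
  have h8 := Finset.sum_le_sum fun j (_ : j ∈ s) => h5 j
  rw [Finset.sum_add_distrib, ← Finset.mul_sum, ← Finset.mul_sum, ← Finset.mul_sum] at h8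
  have h9 := pow_le_pow_left₀ (norm_nonneg _) h1 2
  have h10 := pow_le_pow_left₀ (norm_nonneg _) h2 2
  have h11 := pow_le_pow_left₀ (norm_nonneg _) hRa 2
  have h12 := mul_le_mul_of_nonneg_left (h4.trans h11) (sq_nonneg ‖z‖)
  nlinarith

/-- Moving the factor |E_j - z|² from the coefficients into the functionals makes these a Bessel
family and leaves null coefficients. -/
theorem IsNaimarkComplement.isCompactOperator_of_hasSum (h : IsNaimarkComplement φ ψ)
    (hB : (frameOperator φ E h.parseval_right).IsBounded) {z : ℂ} (hz : z.im ≠ 0)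
    {R Q : K →L[ℂ] K} (hR : (hamiltonian h.parseval_left E).IsResolventAt z R) {η : J → ℂ}
    (hη : Tendsto (fun j => η j / (conj ((E j : ℂ) - z) * ((E j : ℂ) - z))) cofinite (𝓝 0))
    (hQ : ∀ a b, HasSum (fun j => η j * (conj ⟪φ j, R a⟫_ℂ * ⟪φ j, R b⟫_ℂ)) ⟪a, Q b⟫_ℂ) :
    IsCompactOperator Q := by
  obtain ⟨C, hC, hC'⟩ := h.exists_bessel_bound hB hR
  refine isCompactOperator_of_hasSum_inner
    (c := fun j => ((E j : ℂ) - z) • (innerSL ℂ (φ j) ∘L R)) hC ?_ hη fun a b => ?_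
  · exact hC'
  · refine (congrArg (HasSum · _) (funext fun j => ?_)).mpr (hQ a b)
    have hne : (E j : ℂ) - z ≠ 0 := by
      intro h0
      apply hz
      have := congrArg Complex.im h0
      simpa using this
    have hne' : conj ((E j : ℂ) - z) ≠ 0 := (map_ne_zero _).2 hne
    simp only [smul_apply, ContinuousLinearMap.comp_apply, innerSL_apply_apply, smul_eq_mul,
      map_mul]
    field_simp

-- Here ⟨a, R*b⟩ = ⟨Ra, (H - z)Rb⟩. Expanding between `R a` and `R b`, not between `a` and `b`,
-- supplies two resolvent factors for the Bessel bound.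
omit [CompleteSpace M] in
theorem IsNaimarkComplement.hasSum_inner_resolvent (h : IsNaimarkComplement φ ψ)
    (hH : IsSelfAdjoint (hamiltonian h.parseval_left E)) {z : ℂ} {R R' : K →L[ℂ] K}
    (hR : (hamiltonian h.parseval_left E).IsResolventAt z R)
    (hR' : (hamiltonian h.parseval_left E).IsResolventAt (conj z) R') (a b : K) :
    HasSum (fun j => ((E j : ℂ) - z) * (conj ⟪φ j, R a⟫_ℂ * ⟪φ j, R b⟫_ℂ)) ⟪a, R' b⟫_ℂ := by
  obtain ⟨hf, hf'⟩ := hR.1 b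
  have h1 := h.hasSum_inner_sub z (R a) ⟨R b, hf⟩
  have h2 : ⟪a, R' b⟫_ℂ = ⟪R a, b⟫_ℂ := by
    rw [← inner_conj_symm, hH.inner_resolvent hR hR', inner_conj_symm]
  rw [hf'] at h1
  rw [h2]
  exact h1

-- Now H - z is moved across: ⟨(H - z)Ra, Rb⟩ = ⟨Ra, (H - conj z)Rb⟩.
omit [CompleteSpace M] in
theorem IsNaimarkComplement.hasSum_inner_resolvent' (h : IsNaimarkComplement φ ψ)
    (hH : IsSelfAdjoint (hamiltonian h.parseval_left E)) {z : ℂ} {R : K →L[ℂ] K}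
    (hR : (hamiltonian h.parseval_left E).IsResolventAt z R) (a b : K) :
    HasSum (fun j => ((E j : ℂ) - conj z) * (conj ⟪φ j, R a⟫_ℂ * ⟪φ j, R b⟫_ℂ)) ⟪a, R b⟫_ℂ := by
  obtain ⟨hf, hf'⟩ := hR.1 b
  obtain ⟨hg, hg'⟩ := hR.1 a
  have h1 := h.hasSum_inner_sub (conj z) (R a) ⟨R b, hf⟩
  have h2 : ⟪R a, hamiltonian h.parseval_left E ⟨R b, hf⟩ - conj z • R b⟫_ℂ = ⟪a, R b⟫_ℂ := by
    conv_rhs => rw [← hg']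
    rw [inner_sub_right, inner_sub_left, inner_smul_left, inner_smul_right,
      ← hH.inner_apply_left ⟨R a, hg⟩ ⟨R b, hf⟩]
  rw [← h2]
  exact h1

/-- The real part of the resolvent at `l + i` is compact when the energies accumulate
only at `l` and at infinity. -/
theorem IsNaimarkComplement.isCompactOperator_add_resolvent (h : IsNaimarkComplement φ ψ)
    (hH : IsSelfAdjoint (hamiltonian h.parseval_left E))
    (hB : (frameOperator φ E h.parseval_right).IsBounded) {l : ℝ}
    (hl : Tendsto (fun j => (E j - l) / ((E j - l) ^ 2 + 1)) cofinite (𝓝 0)) {R R' : K →L[ℂ] K}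
    (hR : (hamiltonian h.parseval_left E).IsResolventAt (l + Complex.I) R)
    (hR' : (hamiltonian h.parseval_left E).IsResolventAt (conj (l + Complex.I)) R') :
    IsCompactOperator (R + R') := by
  refine h.isCompactOperator_of_hasSum (z := l + Complex.I) (Q := R + R')
    (η := fun j => 2 * ((E j : ℂ) - l)) hB (by simp) hR ?_ fun a b => ?_
  · have h1 := (hl.const_mul 2).ofReal
    rw [mul_zero, Complex.ofReal_zero] at h1
    convert h1 using 1
    funext j
    have h2 : conj ((E j : ℂ) - (l + Complex.I)) * ((E j : ℂ) - (l + Complex.I))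
        = ((E j - l) ^ 2 + 1 : ℝ) := by
      simp only [map_sub, map_add, Complex.conj_ofReal, Complex.conj_I]
      push_cast
      linear_combination -Complex.I_sq
    rw [h2]
    push_cast
    ring
  · rw [add_apply, inner_add_right]
    refine (congrArg (HasSum · _) (funext fun j => ?_)).mpr
      ((h.hasSum_inner_resolvent' hH hR a b).add (h.hasSum_inner_resolvent hH hR hR' a b))
    simp only [map_add, Complex.conj_ofReal, Complex.conj_I]
    ring

/-- The resolvent at -i has the diagonal coefficients 1 / conj(E_j - i), which tend to zero. -/
theorem IsNaimarkComplement.hasCompactResolvent (h : IsNaimarkComplement φ ψ)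
    (hH : IsSelfAdjoint (hamiltonian h.parseval_left E))
    (hB : (frameOperator φ E h.parseval_right).IsBounded)
    (hE : Tendsto (fun j => |E j|) cofinite atTop) :
    (hamiltonian h.parseval_left E).HasCompactResolvent := by
  obtain ⟨R, hR⟩ := hH.exists_isResolventAt (z := Complex.I) (by simp)
  obtain ⟨R', hR'⟩ := hH.exists_isResolventAt (z := conj Complex.I) (by simp)
  refine hR'.hasCompactResolvent (h.isCompactOperator_of_hasSum hB (by simp) hR ?_
    fun a b => h.hasSum_inner_resolvent hH hR hR' a b)
  rw [tendsto_zero_iff_norm_tendsto_zero]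
  have h1 : Tendsto (fun j => ‖(E j : ℂ) - Complex.I‖) cofinite atTop := by
    refine tendsto_atTop_mono (fun j => ?_) hE
    simpa using Complex.abs_re_le_norm ((E j : ℂ) - Complex.I)
  refine h1.inv_tendsto_atTop.congr fun j => ?_
  have hne : (E j : ℂ) - Complex.I ≠ 0 := by
    intro h0
    simpa using congrArg Complex.im h0
  rw [div_mul_cancel_right₀ hne, norm_inv, RCLike.norm_conj, Pi.inv_apply]

/-- Convergent energies are bounded, so the domain is everything, and l - H is a diagonal series in
the Bessel family ⟨φ_j, ·⟩ itself, with null coefficients l - E_j. -/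
theorem IsNaimarkComplement.exists_isCompactOperator_sub (h : IsNaimarkComplement φ ψ)
    {l : ℝ} (hE : Tendsto E cofinite (𝓝 l)) :
    ∃ T : K →L[ℂ] K, IsCompactOperator T ∧
      ∀ f : K, ∃ hf : f ∈ (hamiltonian h.parseval_left E).domain,
        T f = (l : ℂ) • f - hamiltonian h.parseval_left E ⟨f, hf⟩ := by
  obtain ⟨C, hC⟩ : ∃ C, ∀ j, E j ^ 2 ≤ C := by
    obtain ⟨C, hC⟩ := (hE.pow 2).bddAbove_range_of_cofinite
    exact ⟨C, fun j => hC ⟨j, rfl⟩⟩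
  have hle : ∀ f j, E j ^ 2 * ‖⟪φ j, f⟫_ℂ‖ ^ 2 ≤ C * ‖⟪φ j, f⟫_ℂ‖ ^ 2 := fun f j =>
    mul_le_mul_of_nonneg_right (hC j) (by positivity)
  have hdom : ∀ f, f ∈ minDomain φ E := fun f =>
    Summable.of_nonneg_of_le (fun j => by positivity) (hle f)
      ((h.parseval_left f).summable.mul_left C)
  have hbd : ∀ f, ‖hamiltonian h.parseval_left E ⟨f, hdom f⟩‖ ≤ √C * ‖f‖ := by
    intro f
    have h1 := hasSum_le (hle f) (h.hasSum_norm_sq E (hdom f)) ((h.parseval_left f).mul_left C)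
    rw [← Real.sqrt_sq (norm_nonneg f), ← Real.sqrt_mul' _ (sq_nonneg _)]
    refine Real.le_sqrt_of_sq_le ?_
    nlinarith [sq_nonneg ‖frameOperator φ E h.parseval_right ⟨f, hdom f⟩‖]
  let A : K →L[ℂ] K := ((hamiltonian h.parseval_left E).toFun ∘ₗ
    LinearMap.id.codRestrict (minDomain φ E) hdom).mkContinuous (√C) hbd
  have hA : ∀ f, A f = hamiltonian h.parseval_left E ⟨f, hdom f⟩ := fun f => rfl
  have hT : ∀ f, ((l : ℂ) • ContinuousLinearMap.id ℂ K - A) f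
      = (l : ℂ) • f - hamiltonian h.parseval_left E ⟨f, hdom f⟩ := fun f => rfl
  refine ⟨(l : ℂ) • ContinuousLinearMap.id ℂ K - A, ?_, fun f => ⟨hdom f, hT f⟩⟩
  refine isCompactOperator_of_hasSum_inner (c := fun j => innerSL ℂ (φ j))
    (θ := fun j => ((l - E j : ℝ) : ℂ)) (zero_le_one)
    (fun a s => ?_) ?_ fun a b => ?_
  · rw [one_mul]
    exact sum_le_hasSum s (fun j _ => by positivity) (h.parseval_left a)
  · have h1 := (hE.const_sub l).ofReal
    rwa [sub_self] at h1
  · rw [hT, ← neg_sub, inner_neg_right]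
    refine (congrArg (HasSum · _) (funext fun j => ?_)).mpr
      (h.hasSum_inner_sub (l : ℂ) a ⟨b, hdom b⟩).neg
    simp only [innerSL_apply_apply]
    push_cast
    ring

end Compactness

/-! ### Choice of the centre l -/

section Center

open Filter Topology ComplexConjugate

variable {J : Type*} [LinearOrder J] [LocallyFiniteOrder J] {E : J → ℝ}

/-- The function |t| / (t² + 1) is small both for small and for large |t|, and only the finitely
many indices in `[a, b]` escape both alternatives. -/
theorem tendsto_div_sq_add_one_of_ends {l : ℝ}
    (hb : ∀ ε > 0, ∃ a, ∀ j < a, |E j - l| < ε ∨ ε⁻¹ < |E j - l|)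
    (ht : ∀ ε > 0, ∃ b, ∀ j, b < j → |E j - l| < ε ∨ ε⁻¹ < |E j - l|) :
    Tendsto (fun j => (E j - l) / ((E j - l) ^ 2 + 1)) cofinite (𝓝 0) := by
  rw [Metric.tendsto_nhds]
  intro ε hε
  obtain ⟨a, ha⟩ := hb ε hε
  obtain ⟨b, hb⟩ := ht ε hε
  rw [Filter.eventually_cofinite]
  refine (Set.finite_Icc a b).subset fun j hj => ?_
  have key : ¬ (|E j - l| < ε ∨ ε⁻¹ < |E j - l|) := by
    intro h
    refine hj ?_
    rw [dist_zero_right, Real.norm_eq_abs, abs_div, abs_of_pos (a := (E j - l) ^ 2 + 1)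
      (by positivity), div_lt_iff₀ (by positivity), ← sq_abs]
    have h0 := abs_nonneg (E j - l)
    rcases h with h | h
    · nlinarith [mul_nonneg hε.le (sq_nonneg |E j - l|)]
    · rw [inv_lt_iff_one_lt_mul₀ hε] at h
      nlinarith
  exact ⟨not_lt.1 fun h => key (ha j h), not_lt.1 fun h => key (hb j h)⟩

omit [LocallyFiniteOrder J] in
theorem lower_end_of_not_bddBelow (hE : StrictMono E) (h : ¬ BddBelow (Set.range E)) (C : ℝ) :
    ∃ a, ∀ j < a, E j < C := by
  rw [not_bddBelow_iff] at h
  obtain ⟨_, ⟨a, rfl⟩, ha⟩ := h C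
  exact ⟨a, fun j hj => (hE hj).trans ha⟩

omit [LocallyFiniteOrder J] in
theorem upper_end_of_not_bddAbove (hE : StrictMono E) (h : ¬ BddAbove (Set.range E)) (C : ℝ) :
    ∃ b, ∀ j, b < j → C < E j := by
  rw [not_bddAbove_iff] at h
  obtain ⟨_, ⟨a, rfl⟩, ha⟩ := h C
  exact ⟨a, fun j hj => ha.trans (hE hj)⟩

omit [LocallyFiniteOrder J] in
theorem StrictMono.lower_trichotomy [Nonempty J] (hE : StrictMono E) :
    (∃ j₀ : J, ∀ j, j₀ ≤ j) ∨ ¬ BddBelow (Set.range E) ∨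
      ∃ l, IsGLB (Set.range E) l ∧ ∀ j, l < E j := by
  by_cases h : BddBelow (Set.range E)
  · obtain ⟨l, hl⟩ : ∃ l, IsGLB (Set.range E) l := ⟨_, isGLB_csInf (Set.range_nonempty E) h⟩
    by_cases h' : ∀ j, l < E j
    · exact Or.inr (Or.inr ⟨l, hl, h'⟩)
    · push Not at h'
      obtain ⟨j₀, hj₀⟩ := h'
      exact Or.inl ⟨j₀, fun j => hE.le_iff_le.1 (hj₀.trans (hl.1 ⟨j, rfl⟩))⟩
  · exact Or.inr (Or.inl h)

omit [LocallyFiniteOrder J] in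
theorem StrictMono.upper_trichotomy [Nonempty J] (hE : StrictMono E) :
    (∃ j₀ : J, ∀ j, j ≤ j₀) ∨ ¬ BddAbove (Set.range E) ∨
      ∃ l, IsLUB (Set.range E) l ∧ ∀ j, E j < l := by
  by_cases h : BddAbove (Set.range E)
  · obtain ⟨l, hl⟩ : ∃ l, IsLUB (Set.range E) l := ⟨_, isLUB_csSup (Set.range_nonempty E) h⟩
    by_cases h' : ∀ j, E j < l
    · exact Or.inr (Or.inr ⟨l, hl, h'⟩)
    · push Not at h'
      obtain ⟨j₀, hj₀⟩ := h'
      exact Or.inl ⟨j₀, fun j => hE.le_iff_le.1 ((hl.1 ⟨j, rfl⟩).trans hj₀)⟩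
  · exact Or.inr (Or.inl h)

omit [LinearOrder J] [LocallyFiniteOrder J] in
theorem tendsto_div_sq_add_one_of_abs {l : ℝ} (h : Tendsto (fun j => |E j|) cofinite atTop) :
    Tendsto (fun j => (E j - l) / ((E j - l) ^ 2 + 1)) cofinite (𝓝 0) := by
  have h1 : Tendsto (fun j => |E j - l|) cofinite atTop := by
    refine tendsto_atTop_mono (fun j => ?_) (tendsto_atTop_add_const_right _ (-|l|) h)
    linarith [abs_sub_abs_le_abs_sub (E j) l]
  rw [tendsto_zero_iff_norm_tendsto_zero]
  refine squeeze_zero' (Eventually.of_forall fun j => norm_nonneg _) ?_ h1.inv_tendsto_atTop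
  filter_upwards [h1.eventually_gt_atTop 0] with j hj
  rw [Real.norm_eq_abs, abs_div, abs_of_pos (a := (E j - l) ^ 2 + 1) (by positivity),
    Pi.inv_apply, div_le_iff₀ (by positivity), ← sq_abs, inv_mul_eq_div, le_div_iff₀ hj]
  nlinarith

/-- Either the energies tend to infinity in absolute value, or they lie on one side of a real
number `l` and accumulate only at `l` and at infinity. -/
theorem StrictMono.exists_center [Infinite J] (hE : StrictMono E)
    (hJ : (∃ j₀ : J, ∀ j, j₀ ≤ j) ∨ (∃ j₀ : J, ∀ j, j ≤ j₀) ∨ ∀ C : ℝ, ∃ j, C < |E j|) :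
    Tendsto (fun j => |E j|) cofinite atTop ∨
      ∃ l : ℝ, ((∀ j, l < E j) ∨ ∀ j, E j < l) ∧
        Tendsto (fun j => (E j - l) / ((E j - l) ^ 2 + 1)) cofinite (𝓝 0) := by
  have b1 : (∃ j₀ : J, ∀ j, j₀ ≤ j) → ∀ l : ℝ,
      ∀ ε > 0, ∃ a, ∀ j < a, |E j - l| < ε ∨ ε⁻¹ < |E j - l| :=
    fun ⟨j₀, hj₀⟩ l ε _ => ⟨j₀, fun j hj => absurd hj (hj₀ j).not_gt⟩
  have t1 : (∃ j₀ : J, ∀ j, j ≤ j₀) → ∀ l : ℝ,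
      ∀ ε > 0, ∃ b, ∀ j, b < j → |E j - l| < ε ∨ ε⁻¹ < |E j - l| :=
    fun ⟨j₀, hj₀⟩ l ε _ => ⟨j₀, fun j hj => absurd hj (hj₀ j).not_gt⟩
  have b2 : ¬ BddBelow (Set.range E) → ∀ l : ℝ,
      ∀ ε > 0, ∃ a, ∀ j < a, |E j - l| < ε ∨ ε⁻¹ < |E j - l| := by
    intro h l ε _
    obtain ⟨a, ha⟩ := lower_end_of_not_bddBelow hE h (l - ε⁻¹)
    exact ⟨a, fun j hj => Or.inr (lt_abs.2 (Or.inr (by linarith [ha j hj])))⟩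
  have t2 : ¬ BddAbove (Set.range E) → ∀ l : ℝ,
      ∀ ε > 0, ∃ b, ∀ j, b < j → |E j - l| < ε ∨ ε⁻¹ < |E j - l| := by
    intro h l ε _
    obtain ⟨b, hb⟩ := upper_end_of_not_bddAbove hE h (l + ε⁻¹)
    exact ⟨b, fun j hj => Or.inr (lt_abs.2 (Or.inl (by linarith [hb j hj])))⟩
  have b3 : ∀ l, IsGLB (Set.range E) l →
      ∀ ε > 0, ∃ a, ∀ j < a, |E j - l| < ε ∨ ε⁻¹ < |E j - l| := by
    intro l hl ε hε
    obtain ⟨_, ⟨a, rfl⟩, -, ha⟩ := hl.exists_between (lt_add_of_pos_right l hε)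
    refine ⟨a, fun j hj => Or.inl (abs_lt.2 ⟨?_, ?_⟩)⟩
    · linarith [hl.1 ⟨j, rfl⟩]
    · linarith [hE hj]
  have t3 : ∀ l, IsLUB (Set.range E) l →
      ∀ ε > 0, ∃ b, ∀ j, b < j → |E j - l| < ε ∨ ε⁻¹ < |E j - l| := by
    intro l hl ε hε
    obtain ⟨_, ⟨a, rfl⟩, ha, -⟩ := hl.exists_between (sub_lt_self l hε)
    refine ⟨a, fun j hj => Or.inl (abs_lt.2 ⟨?_, ?_⟩)⟩
    · linarith [hE hj]
    · linarith [hl.1 ⟨j, rfl⟩]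
  -- At each end of the index set there is an extreme index, or the energies are unbounded, or they
  -- approach a finite bound that is not attained.
  rcases hE.lower_trichotomy with hb | hb | ⟨l, hb, hb'⟩ <;>
  rcases hE.upper_trichotomy with ht | ht | ⟨m, ht, ht'⟩
  · obtain ⟨a, ha⟩ := hb
    obtain ⟨b, hb⟩ := ht
    exact absurd ((Set.finite_Icc a b).subset fun j _ => ⟨ha j, hb j⟩) Set.infinite_univ
  · obtain ⟨a, ha⟩ := hb
    -- With no finite accumulation point, any number below the least energy would serve.
    refine Or.inr ⟨E a - 1, Or.inl fun j => ?_, tendsto_div_sq_add_one_of_ends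
      (b1 ⟨a, ha⟩ _) (t2 ht _)⟩
    linarith [hE.monotone (ha j)]
  · exact Or.inr ⟨m, Or.inr ht', tendsto_div_sq_add_one_of_ends (b1 hb _) (t3 m ht)⟩
  · obtain ⟨a, ha⟩ := ht
    refine Or.inr ⟨E a + 1, Or.inr fun j => ?_, tendsto_div_sq_add_one_of_ends
      (b2 hb _) (t1 ⟨a, ha⟩ _)⟩
    linarith [hE.monotone (ha j)]
  · refine Or.inl (Filter.tendsto_atTop.2 fun C => ?_)
    obtain ⟨a, ha⟩ := lower_end_of_not_bddBelow hE hb (-C)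
    obtain ⟨b, hb⟩ := upper_end_of_not_bddAbove hE ht C
    rw [Filter.eventually_cofinite]
    refine (Set.finite_Icc a b).subset fun j hj => ⟨not_lt.1 fun h => ?_, not_lt.1 fun h => ?_⟩
    · exact hj (le_abs.2 (Or.inr (by linarith [ha j h])))
    · exact hj (le_abs.2 (Or.inl (hb j h).le))
  · exact Or.inr ⟨m, Or.inr ht', tendsto_div_sq_add_one_of_ends (b2 hb _) (t3 m ht)⟩
  · exact Or.inr ⟨l, Or.inl hb', tendsto_div_sq_add_one_of_ends (b3 l hb) (t1 ht _)⟩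
  · exact Or.inr ⟨l, Or.inl hb', tendsto_div_sq_add_one_of_ends (b3 l hb) (t2 ht _)⟩
  -- Two finite accumulation points could not both be the centre; `hJ` excludes this case.
  · exfalso
    rcases hJ with ⟨j₀, h⟩ | ⟨j₀, h⟩ | h
    · have : E j₀ ≤ l := hb.2 (by rintro _ ⟨j, rfl⟩; exact hE.monotone (h j))
      exact absurd (hb' j₀) this.not_gt
    · have : m ≤ E j₀ := ht.2 (by rintro _ ⟨j, rfl⟩; exact hE.monotone (h j))
      exact absurd (ht' j₀) this.not_gt
    · obtain ⟨j, hj⟩ := h (max |l| |m|)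
      exact absurd hj (abs_le_max_abs_abs (hb' j).le (ht' j).le).not_gt

end Center

/-! ### Real numbers that are not eigenvalues -/

section Eigenvalues

open Filter Topology ComplexConjugate

variable {J : Type*} {K : Type*} [NormedAddCommGroup K] [InnerProductSpace ℂ K]
  {M : Type*} [NormedAddCommGroup M] [InnerProductSpace ℂ M]
  {φ : J → K} {ψ : J → M} {E : J → ℝ}

/-- The form ⟨v, (H - l)v⟩ = ∑ (E_j - l)|⟨φ_j, v⟩|² has terms of one sign, so if it vanishes then so
do all frame coefficients of v. -/
theorem IsNaimarkComplement.eigenspaceAt_eq_bot [CompleteSpace K] (h : IsNaimarkComplement φ ψ)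
    {l : ℝ} (hl : (∀ j, l < E j) ∨ ∀ j, E j < l) :
    (hamiltonian h.parseval_left E).eigenspaceAt l = ⊥ := by
  rw [Submodule.eq_bot_iff]
  rintro v ⟨hv, hv'⟩
  have h1 := h.hasSum_inner_sub (l : ℂ) v ⟨v, hv⟩
  rw [hv', sub_self, inner_zero_right] at h1
  have h2 : HasSum (fun j => (E j - l) * ‖⟪φ j, v⟫_ℂ‖ ^ 2) 0 := by
    refine (congrArg (HasSum · _) (funext fun j => ?_)).mpr (Complex.reCLM.hasSum h1)
    rw [Complex.conj_mul', ← Complex.ofReal_sub, ← Complex.ofReal_pow, ← Complex.ofReal_mul]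
    exact (Complex.ofReal_re _).symm
  refine h.parseval_left.eq_zero fun j => ?_
  have h3 : (E j - l) * ‖⟪φ j, v⟫_ℂ‖ ^ 2 = 0 := by
    rcases hl with hl | hl
    · exact congrFun ((hasSum_zero_iff_of_nonneg fun i =>
        mul_nonneg (sub_nonneg.2 (hl i).le) (by positivity)).1 h2) j
    · have h4 := h2.neg
      rw [neg_zero] at h4
      exact neg_eq_zero.1 (congrFun ((hasSum_zero_iff_of_nonneg fun i =>
        neg_nonneg.2 (mul_nonpos_of_nonpos_of_nonneg (sub_nonpos.2 (hl i).le)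
          (by positivity))).1 h4) j)
  have h5 : E j - l ≠ 0 := by
    rcases hl with hl | hl
    · exact (sub_pos.2 (hl j)).ne'
    · exact (sub_neg.2 (hl j)).ne
  simpa using (mul_eq_zero.1 h3).resolve_left h5

theorem Orthonormal.countable [TopologicalSpace.SeparableSpace K] {ι : Type*} {e : ι → K}
    (he : Orthonormal ℂ e) : Countable ι := by
  have h : Pairwise (Function.onFun Disjoint fun i => Metric.ball (e i) (1 / 2)) := by
    intro i j hij
    refine Metric.ball_disjoint_ball ?_
    have h1 : ‖e i - e j‖ ^ 2 = 2 := by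
      rw [@norm_sub_sq ℂ, he.2 hij, he.1, he.1]
      norm_num
    rw [dist_eq_norm]
    nlinarith [norm_nonneg (e i - e j)]
  have h2 := h.pairwiseDisjoint Set.univ |>.countable_of_isOpen (fun i _ => Metric.isOpen_ball)
    fun i _ => ⟨e i, Metric.mem_ball_self (by norm_num)⟩
  exact Set.countable_univ_iff.1 h2

/-- Otherwise normalized eigenvectors would form an orthonormal family indexed by ℝ, which is
uncountable. -/
theorem IsSelfAdjoint.exists_eigenspaceAt_eq_bot [CompleteSpace K]
    [TopologicalSpace.SeparableSpace K] {T : K →ₗ.[ℂ] K} (hT : IsSelfAdjoint T) :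
    ∃ l : ℝ, T.eigenspaceAt l = ⊥ := by
  by_contra! hne
  have h : ∀ l : ℝ, ∃ v ∈ T.eigenspaceAt l, v ≠ 0 := fun l => (Submodule.ne_bot_iff _).1 (hne l)
  choose v hv hv0 using h
  have ho : Orthonormal ℂ fun l => ((‖v l‖ : ℂ)⁻¹ • v l) := by
    refine ⟨fun l => ?_, fun l m hlm => ?_⟩
    · rw [norm_smul, norm_inv, Complex.norm_real, norm_norm,
        inv_mul_cancel₀ (norm_ne_zero_iff.2 (hv0 l))]
    · simp only [inner_smul_left, inner_smul_right,
        hT.inner_eq_zero_of_mem_eigenspaceAt hlm (hv l) (hv m), mul_zero]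
  exact not_countable (α := ℝ) ho.countable

end Eigenvalues

/-! ### Eigenbasis from the real part of a resolvent -/

section Eigenbasis

open Filter Topology ComplexConjugate

variable {K : Type*} [NormedAddCommGroup K] [InnerProductSpace ℂ K]
  {T : K →ₗ.[ℂ] K} {l : ℝ} {R R' : K →L[ℂ] K}

theorem LinearPMap.add_resolvent_apply_eigenvector
    (hR : T.IsResolventAt (l + Complex.I) R) (hR' : T.IsResolventAt (conj (l + Complex.I)) R')
    {μ : ℝ} {v : K} (hv : v ∈ T.eigenspaceAt μ) :
    (R + R') v = ((2 * ((μ - l) / ((μ - l) ^ 2 + 1)) : ℝ) : ℂ) • v := by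
  have h1 : (μ : ℂ) - (l + Complex.I) ≠ 0 := fun h => by
    simpa using congrArg Complex.im h
  have h2 : (μ : ℂ) - conj (l + Complex.I) ≠ 0 := fun h => by
    simpa using congrArg Complex.im h
  have h3 : (((μ - l) ^ 2 + 1 : ℝ) : ℂ) ≠ 0 := by
    have : (μ - l) ^ 2 + 1 ≠ 0 := by positivity
    exact_mod_cast this
  rw [_root_.add_apply, hR.apply_eigenvector hv (sub_ne_zero.1 h1),
    hR'.apply_eigenvector hv (sub_ne_zero.1 h2), ← add_smul]
  congr 1
  push_cast at h3 ⊢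
  simp only [_root_.map_add, Complex.conj_ofReal, Complex.conj_I] at h2 ⊢
  field_simp
  linear_combination (2 * (μ - l : ℂ)) * Complex.I_sq

/-- If R'v = -Rv, subtracting the two resolvent equations cancels v and the terms in i, leaving 2(T
- l)Rv = 0. -/
theorem LinearPMap.add_resolvent_injective (hl : T.eigenspaceAt l = ⊥)
    (hR : T.IsResolventAt (l + Complex.I) R) (hR' : T.IsResolventAt (conj (l + Complex.I)) R')
    {v : K} (hv : (R + R') v = 0) : v = 0 := by
  obtain ⟨h1, h1'⟩ := hR.1 v
  obtain ⟨h2, h2'⟩ := hR'.1 v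
  have h3 : R' v = -R v := by
    rw [_root_.add_apply, add_comm] at hv
    exact eq_neg_of_add_eq_zero_left hv
  have h4 : T ⟨R' v, h2⟩ = - T ⟨R v, h1⟩ := by
    rw [← T.map_neg]
    congr 1
    exact Subtype.ext h3
  rw [h4, h3] at h2'
  have h5 : R v ∈ T.eigenspaceAt l := by
    refine ⟨h1, ?_⟩
    have h6 : (2 : ℂ) • (T ⟨R v, h1⟩ - (l : ℂ) • R v) = 0 := by
      have h7 := h1'.trans h2'.symm
      simp only [_root_.map_add, Complex.conj_ofReal, Complex.conj_I] at h7
      linear_combination (norm := module) h7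
    exact sub_eq_zero.1 ((smul_eq_zero.1 h6).resolve_left two_ne_zero)
  rw [hl, Submodule.mem_bot] at h5
  exact hR.injective h5

variable [CompleteSpace K]

/-- For μ ≠ l the eigenspace lies in an eigenspace of the compact operator `R + R'` for a nonzero
eigenvalue. -/
theorem IsSelfAdjoint.finiteDimensional_eigenspaceAt
    (hl : T.eigenspaceAt l = ⊥)
    (hR : T.IsResolventAt (l + Complex.I) R) (hR' : T.IsResolventAt (conj (l + Complex.I)) R')
    (hc : IsCompactOperator (R + R')) (μ : ℝ) : FiniteDimensional ℂ (T.eigenspaceAt μ) := by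
  rcases eq_or_ne μ l with rfl | hμ
  · rw [hl]; infer_instance
  · have hne : ((2 * ((μ - l) / ((μ - l) ^ 2 + 1)) : ℝ) : ℂ) ≠ 0 := by
      have h1 : μ - l ≠ 0 := sub_ne_zero.2 hμ
      have h2 : (μ - l) ^ 2 + 1 ≠ 0 := by positivity
      rw [Complex.ofReal_ne_zero]
      exact mul_ne_zero two_ne_zero (div_ne_zero h1 h2)
    have := ContinuousLinearMap.finite_dimensional_eigenspace (T := R + R') hc _ hne
    refine Submodule.finiteDimensional_of_le (S₂ := Module.End.eigenspace
      (R + R').toLinearMap ((2 * ((μ - l) / ((μ - l) ^ 2 + 1)) : ℝ) : ℂ)) fun v hv => ?_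
    rw [Module.End.mem_eigenspace_iff]
    exact LinearPMap.add_resolvent_apply_eigenvector hR hR' hv

/-- If the real part of a resolvent is compact and injective, the eigenvectors are complete. -/
theorem IsSelfAdjoint.eq_zero_of_forall_inner_eigenvector_eq_zero (hT : IsSelfAdjoint T)
    (hl : T.eigenspaceAt l = ⊥)
    (hR : T.IsResolventAt (l + Complex.I) R) (hR' : T.IsResolventAt (conj (l + Complex.I)) R')
    (hc : IsCompactOperator (R + R')) {g : K}
    (hg : ∀ μ : ℝ, ∀ v ∈ T.eigenspaceAt μ, ⟪v, g⟫_ℂ = 0) : g = 0 := by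
  have hne : (l + Complex.I) ≠ conj (l + Complex.I) := by
    intro h
    have := congrArg Complex.im h
    norm_num at this
  have hcomm := hR.comm hne hR'
  have hadj : ∀ a b, ⟪R' a, b⟫_ℂ = ⟪a, R b⟫_ℂ := hT.inner_resolvent hR hR'
  have hadj' : ∀ a b, ⟪R a, b⟫_ℂ = ⟪a, R' b⟫_ℂ := by
    intro a b
    rw [← inner_conj_symm, ← hadj, inner_conj_symm]
  have hsymm : (R + R' : K →L[ℂ] K).IsSymmetric := by
    intro a b
    simp only [ContinuousLinearMap.coe_coe, add_apply, inner_add_left, inner_add_right, hadj, hadj']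
    ring
  have hspec := ContinuousLinearMap.orthogonalComplement_iSup_eigenspaces_eq_bot hc hsymm
  -- Distinct μ symmetric about the value μ - l = ±1 can share an eigenvalue of `R + R'`, for
  -- instance x and 1/x as values of μ - l; the imaginary part `D` separates them, since R = ((R +
  -- R') + iD) / 2.
  let D : K →L[ℂ] K := (-Complex.I) • (R - R')
  have hDsymm : (D : K →ₗ[ℂ] K).IsSymmetric := by
    intro a b
    simp only [D, ContinuousLinearMap.coe_coe, smul_apply, sub_apply, inner_smul_left,
      inner_smul_right, inner_sub_left, inner_sub_right, hadj, hadj', map_neg, Complex.conj_I]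
    ring
  suffices h : g ∈ (⨆ s, Module.End.eigenspace ((R + R' : K →L[ℂ] K) : K →ₗ[ℂ] K) s)ᗮ by
    rwa [hspec, Submodule.mem_bot] at h
  rw [Submodule.mem_orthogonal]
  intro w hw
  induction hw using Submodule.iSup_induction' with
  | zero => exact inner_zero_left _
  | add x y _ _ hx hy => rw [inner_add_left, hx, hy, add_zero]
  | mem s w hw =>
    set W := Module.End.eigenspace ((R + R' : K →L[ℂ] K) : K →ₗ[ℂ] K) s with hW
    have hWmem : ∀ {x}, x ∈ W ↔ R x + R' x = s • x := fun {x} => Module.End.mem_eigenspace_iff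
    rcases eq_or_ne s 0 with rfl | hs
    · have : w = 0 := LinearPMap.add_resolvent_injective hl hR hR' (by
        rw [add_apply, hWmem.1 hw, zero_smul])
      rw [this, inner_zero_left]
    have hfd : FiniteDimensional ℂ W :=
      ContinuousLinearMap.finite_dimensional_eigenspace (T := R + R') hc s hs
    have hRW : ∀ x ∈ W, R x ∈ W := by
      intro x hx
      rw [hWmem] at hx ⊢
      rw [← hcomm, ← R.map_add, hx, R.map_smul]
    have hRW' : ∀ x ∈ W, R' x ∈ W := by
      intro x hx
      rw [hWmem] at hx ⊢
      rw [hcomm, ← R'.map_add, hx, R'.map_smul]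
    have hDW : ∀ x ∈ W, (D : K →ₗ[ℂ] K) x ∈ W := fun x hx =>
      W.smul_mem _ (W.sub_mem (hRW x hx) (hRW' x hx))
    have hD := (hDsymm.restrict_invariant hDW).orthogonalComplement_iSup_eigenspaces_eq_bot
    rw [Submodule.orthogonal_eq_bot_iff] at hD
    have hw' : (⟨w, hw⟩ : W) ∈ ⨆ t, Module.End.eigenspace ((D : K →ₗ[ℂ] K).restrict hDW) t := by
      rw [hD]; trivial
    have key : ∀ x : W, x ∈ (⨆ t, Module.End.eigenspace ((D : K →ₗ[ℂ] K).restrict hDW) t) →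
        ⟪(x : K), g⟫_ℂ = 0 := by
      intro x hx
      induction hx using Submodule.iSup_induction' with
      | zero => exact inner_zero_left _
      | add x y _ _ hx hy => rw [Submodule.coe_add, inner_add_left, hx, hy, add_zero]
      | mem t x hx =>
        have h1 : D (x : K) = t • (x : K) :=
          congrArg Subtype.val (Module.End.mem_eigenspace_iff.1 hx)
        have h2 := hWmem.1 x.2
        have h3 : R (x : K) = ((s + Complex.I * t) / 2) • (x : K) := by
          have h4 : R (x : K) - R' (x : K) = (Complex.I * t) • (x : K) := by
            rw [mul_smul, ← h1]
            simp only [D, smul_apply, sub_apply, smul_smul]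
            simp
          have h5 : (2 : ℂ) • R (x : K) = (s + Complex.I * t) • (x : K) := by
            rw [add_smul, ← h2, ← h4, two_smul]
            abel
          rw [div_eq_inv_mul, mul_smul, ← h5, smul_smul, inv_mul_cancel₀ two_ne_zero, one_smul]
        rcases eq_or_ne (x : K) 0 with h0 | h0
        · rw [h0, inner_zero_left]
        -- Injectivity of `R` excludes the value 0, so `x` is an eigenvector of `T`, and
        -- self-adjointness makes its eigenvalue real.
        have hρ : (s + Complex.I * t) / 2 ≠ 0 := by
          intro h
          rw [h, zero_smul] at h3
          exact h0 (hR.injective h3)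
        have h6 := hR.mem_eigenspaceAt hρ h3
        have h7 := hT.im_eq_zero_of_mem_eigenspaceAt h6 h0
        have h8 : (((l + Complex.I + ((s + Complex.I * t) / 2)⁻¹).re : ℝ) : ℂ)
            = l + Complex.I + ((s + Complex.I * t) / 2)⁻¹ := Complex.ext (by simp) (by rw [h7]; simp)
        rw [← h8] at h6
        exact hg _ _ h6
    exact key _ hw'

/-- A self-adjoint operator for which the real part of a resolvent is compact and injective has an
orthonormal basis of eigenvectors. -/
theorem IsSelfAdjoint.exists_hilbertBasis_eigenvectors [TopologicalSpace.SeparableSpace K]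
    (hK : ¬ FiniteDimensional ℂ K) {J : Type*} [Countable J] [Infinite J] (hT : IsSelfAdjoint T)
    (hl : T.eigenspaceAt l = ⊥)
    (hR : T.IsResolventAt (l + Complex.I) R) (hR' : T.IsResolventAt (conj (l + Complex.I)) R')
    (hc : IsCompactOperator (R + R')) :
    ∃ (e : HilbertBasis J ℂ K) (E : J → ℝ), ∀ j, e j ∈ T.eigenspaceAt (E j) := by
  have hfd := IsSelfAdjoint.finiteDimensional_eigenspaceAt hl hR hR' hc
  have hof : OrthogonalFamily ℂ (fun μ : ℝ => T.eigenspaceAt μ)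
      (fun μ => (T.eigenspaceAt μ).subtypeₗᵢ) := fun μ ν hμν u v =>
    hT.inner_eq_zero_of_mem_eigenspaceAt hμν u.2 v.2
  let b := fun μ : ℝ => stdOrthonormalBasis ℂ (T.eigenspaceAt μ)
  let ι := Σ μ : ℝ, Fin (Module.finrank ℂ (T.eigenspaceAt μ))
  let v : ι → K := fun a => (b a.1 a.2 : K)
  have hv : Orthonormal ℂ v := hof.orthonormal_sigma_orthonormal fun μ => (b μ).orthonormal
  have hbot : (Submodule.span ℂ (Set.range v))ᗮ = ⊥ := by
    rw [Submodule.eq_bot_iff]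
    intro g hg
    refine hT.eq_zero_of_forall_inner_eigenvector_eq_zero hl hR hR' hc fun μ u hu => ?_
    have h1 : ∀ i, ⟪(b μ i : K), g⟫_ℂ = 0 := fun i =>
      (Submodule.mem_orthogonal _ _).1 hg _ (Submodule.subset_span ⟨⟨μ, i⟩, rfl⟩)
    have h2 := congrArg Subtype.val ((b μ).sum_repr ⟨u, hu⟩)
    simp only [Submodule.coe_sum, Submodule.coe_smul] at h2
    rw [← h2, sum_inner]
    exact Finset.sum_eq_zero fun i _ => by rw [inner_smul_left, h1, mul_zero]
  have hcount : Countable ι := hv.countable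
  have hinf : Infinite ι := by
    by_contra hfin
    rw [not_infinite_iff_finite] at hfin
    refine hK ?_
    have h1 : FiniteDimensional ℂ (Submodule.span ℂ (Set.range v)) :=
      FiniteDimensional.span_of_finite ℂ (Set.finite_range v)
    rw [Submodule.orthogonal_eq_bot_iff] at hbot
    rw [hbot] at h1
    exact Module.Finite.equiv (Submodule.topEquiv (R := ℂ) (M := K))
  -- Both index sets are countably infinite, so the eigenvectors can be relabelled by `J`; the order
  -- of `J` plays no role here.
  obtain ⟨f⟩ : Nonempty (J ≃ ι) := nonempty_equiv_of_countable
  have hv' := hv.comp f f.injective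
  have hbot' : (Submodule.span ℂ (Set.range (v ∘ f)))ᗮ = ⊥ := by
    rwa [f.surjective.range_comp]
  refine ⟨HilbertBasis.mkOfOrthogonalEqBot hv' hbot', fun j => (f j).1, fun j => ?_⟩
  rw [HilbertBasis.coe_mkOfOrthogonalEqBot]
  exact (b (f j).1 (f j).2).2

end Eigenbasis

/-! ### Diagonal form of the operator -/

section Diagonal

open Filter Topology ComplexConjugate

variable {J : Type*} {K : Type*} [NormedAddCommGroup K] [InnerProductSpace ℂ K] [CompleteSpace K]
  {T : K →ₗ.[ℂ] K} {e : HilbertBasis J ℂ K} {E : J → ℝ}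

theorem IsSelfAdjoint.inner_basis_apply (hT : IsSelfAdjoint T)
    (he : ∀ j, e j ∈ T.eigenspaceAt (E j)) (f : T.domain) (j : J) :
    ⟪e j, T f⟫_ℂ = E j * ⟪e j, (f : K)⟫_ℂ := by
  obtain ⟨h, h'⟩ := he j
  rw [← hT.inner_apply_left ⟨e j, h⟩ f, h', inner_smul_left, Complex.conj_ofReal]

/-- A self-adjoint operator with an orthonormal basis of eigenvectors is the diagonal operator
defined by the basis and the eigenvalues. -/
theorem IsSelfAdjoint.eq_hamiltonian (hT : IsSelfAdjoint T)
    (he : ∀ j, e j ∈ T.eigenspaceAt (E j)) : T = hamiltonian e.isParsevalFrame E := by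
  have hdom : ∀ f, f ∈ T.domain ↔ f ∈ minDomain (fun j => e j) E := by
    intro f
    constructor
    · intro hf
      refine (e.isParsevalFrame (T ⟨f, hf⟩)).summable.congr fun j => ?_
      rw [hT.inner_basis_apply he, norm_mul, mul_pow, Complex.norm_real, Real.norm_eq_abs, sq_abs]
    · intro hf
      -- The diagonal series is the candidate for `T f`; pairing it with the domain of `T` puts `f`
      -- in the domain of the adjoint, which is that of `T`.
      refine (hT.exists_mem_domain (w := hamiltonian e.isParsevalFrame E ⟨f, hf⟩) fun g => ?_).1
      have h1 := inner_frameOperator_hasSum (fun j => e j) E e.isParsevalFrame (g : K) ⟨f, hf⟩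
      have h2 := e.hasSum_inner_mul_inner (T g) f
      have h3 : ⟪T g, f⟫_ℂ = ⟪(g : K), hamiltonian e.isParsevalFrame E ⟨f, hf⟩⟫_ℂ := by
        refine h2.unique ((congrArg (HasSum · _) (funext fun j => ?_)).mpr h1)
        rw [← inner_conj_symm, hT.inner_basis_apply he, map_mul, Complex.conj_ofReal]
        ring
      rw [← inner_conj_symm, ← h3, inner_conj_symm]
  refine LinearPMap.ext (Submodule.ext hdom) fun f hf hf' => ?_
  refine (e.hasSum_repr (T ⟨f, hf⟩)).unique ((congrArg (HasSum · _) (funext fun j => ?_)).mpr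
    (e.isParsevalFrame.summable_smul (minDomain.summable_sq hf')).hasSum)
  rw [e.repr_apply_apply, hT.inner_basis_apply he]

end Diagonal

/-! ### Spectrum of a diagonal operator -/

section DiagonalSpectrum

open Filter Topology ComplexConjugate

variable {J : Type*} {K : Type*} [NormedAddCommGroup K] [InnerProductSpace ℂ K] [CompleteSpace K]
  {T : K →ₗ.[ℂ] K} {e : HilbertBasis J ℂ K} {E : J → ℝ}

theorem IsSelfAdjoint.eq_zero_of_mem_eigenspaceAt (hT : IsSelfAdjoint T)
    (he : ∀ j, e j ∈ T.eigenspaceAt (E j)) {w : ℂ} (hw : ∀ j, (E j : ℂ) ≠ w) {v : K}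
    (hv : v ∈ T.eigenspaceAt w) : v = 0 := by
  obtain ⟨hv, hv'⟩ := hv
  refine e.isParsevalFrame.eq_zero fun j => ?_
  have h := hT.inner_basis_apply he ⟨v, hv⟩ j
  rw [hv', inner_smul_right] at h
  have h2 : ((E j : ℂ) - w) * ⟪e j, v⟫_ℂ = 0 := by
    rw [sub_mul, sub_eq_zero]
    exact h.symm
  exact (mul_eq_zero.1 h2).resolve_left (sub_ne_zero.2 (hw j))

/-- A point away from the eigenvalues of an orthonormal basis of eigenvectors is in the
resolvent set. -/
theorem IsSelfAdjoint.notMem_opSpectrum_of_le (hT : IsSelfAdjoint T)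
    (he : ∀ j, e j ∈ T.eigenspaceAt (E j)) {w : ℂ} {δ : ℝ} (hδ : 0 < δ)
    (hw : ∀ j, δ ≤ ‖(E j : ℂ) - w‖) : w ∉ T.opSpectrum := by
  refine not_not.2 (hT.exists_isResolventAt_of_bound hδ (fun f => ?_) fun g hg => ?_)
  · have h1 := (e.isParsevalFrame (f : K)).mul_left (δ ^ 2)
    have h2 := e.isParsevalFrame (T f - w • (f : K))
    have h3 := hasSum_le (fun j => ?_) h1 h2
    · rw [← mul_pow] at h3
      exact le_of_sq_le_sq h3 (norm_nonneg _)
    · rw [inner_sub_right, inner_smul_right, hT.inner_basis_apply he, ← sub_mul, norm_mul, mul_pow]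
      exact mul_le_mul_of_nonneg_right (pow_le_pow_left₀ hδ.le (hw j) 2) (by positivity)
  · refine hT.eq_zero_of_mem_eigenspaceAt he (fun j hj => ?_) hg
    have h1 : (E j : ℂ) = w := by
      rw [← Complex.conj_conj w, ← hj, Complex.conj_ofReal]
    have h2 := hw j
    rw [h1, sub_self, norm_zero] at h2
    exact absurd h2 hδ.not_ge

theorem exists_pos_le_norm_sub_of_finite {w : ℂ} {ε : ℝ} (hε : 0 < ε)
    (hfin : {j | ‖(E j : ℂ) - w‖ < ε}.Finite) :
    ∃ δ > 0, ∀ j, (E j : ℂ) ≠ w → δ ≤ ‖(E j : ℂ) - w‖ := by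
  have h1 : IsClosed (((fun j => (E j : ℂ)) '' {j | ‖(E j : ℂ) - w‖ < ε}) \ {w}) :=
    ((hfin.image _).subset Set.sdiff_subset).isClosed
  obtain ⟨δ, hδ, h2⟩ := Metric.isOpen_iff.1 h1.isOpen_compl w (by simp)
  refine ⟨min δ ε, lt_min hδ hε, fun j hj => ?_⟩
  by_contra! h
  rw [lt_min_iff] at h
  refine h2 (a := (E j : ℂ)) (by rw [Metric.mem_ball, dist_eq_norm]; exact h.1) ⟨⟨j, h.2, rfl⟩, hj⟩

theorem IsSelfAdjoint.notMem_opSpectrum_of_finite (hT : IsSelfAdjoint T)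
    (he : ∀ j, e j ∈ T.eigenspaceAt (E j)) {w : ℂ} (hw : ∀ j, (E j : ℂ) ≠ w) {ε : ℝ} (hε : 0 < ε)
    (hfin : {j | ‖(E j : ℂ) - w‖ < ε}.Finite) : w ∉ T.opSpectrum := by
  obtain ⟨δ, hδ, h⟩ := exists_pos_le_norm_sub_of_finite hε hfin
  exact hT.notMem_opSpectrum_of_le he hδ fun j => h j (hw j)

omit [CompleteSpace K] in
theorem HilbertBasis.range_subset_opSpectrum (he : ∀ j, e j ∈ T.eigenspaceAt (E j)) :
    Set.range (fun j => (E j : ℂ)) ⊆ T.opSpectrum := by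
  rintro _ ⟨j, rfl⟩
  exact LinearPMap.mem_opSpectrum_of_eigenvector (he j) (e.orthonormal.ne_zero j)

theorem IsSelfAdjoint.discreteSpectrum_eq_range (hT : IsSelfAdjoint T)
    (he : ∀ j, e j ∈ T.eigenspaceAt (E j))
    (hfd : ∀ j, FiniteDimensional ℂ (T.eigenspaceAt (E j)))
    (hfin : ∀ i, ∃ ε > 0, {j | ‖(E j : ℂ) - E i‖ < ε}.Finite) :
    T.discreteSpectrum = Set.range (fun j => (E j : ℂ)) := by
  refine Set.Subset.antisymm ?_ ?_
  · rintro z ⟨-, -, hz, -⟩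
    by_contra h
    refine hz ((Submodule.eq_bot_iff _).2 fun v hv => ?_)
    exact hT.eq_zero_of_mem_eigenspaceAt he (fun j hj => h ⟨j, hj⟩) hv
  · rintro _ ⟨i, rfl⟩
    refine ⟨HilbertBasis.range_subset_opSpectrum he ⟨i, rfl⟩, ?_, ?_, hfd i⟩
    · obtain ⟨ε, hε, hf⟩ := hfin i
      obtain ⟨δ, hδ, h⟩ := exists_pos_le_norm_sub_of_finite hε hf
      refine ⟨min δ (ε / 2), lt_min hδ (by positivity), fun w hw hd => ?_⟩
      rw [lt_min_iff, dist_eq_norm] at hd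
      by_cases hr : ∃ j, (E j : ℂ) = w
      · obtain ⟨j, rfl⟩ := hr
        by_contra hne
        exact absurd hd.1 (h j hne).not_gt
      · push Not at hr
        -- The ball of radius `ε / 2` about `w` lies in the ball of radius `ε` about `E i`, so it
        -- too contains `E j` for only finitely many `j`.
        refine absurd hw (hT.notMem_opSpectrum_of_finite he hr (half_pos hε) (hf.subset ?_))
        intro j hj
        have h1 := norm_add_le ((E j : ℂ) - w) (w - E i)
        rw [sub_add_sub_cancel] at h1
        have h2 : ‖(E j : ℂ) - w‖ < ε / 2 := hj
        change ‖(E j : ℂ) - E i‖ < ε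
        linarith [hd.2]
    · exact (Submodule.ne_bot_iff _).2 ⟨e i, he i, e.orthonormal.ne_zero i⟩

theorem IsSelfAdjoint.opSpectrum_eq_range (hT : IsSelfAdjoint T)
    (he : ∀ j, e j ∈ T.eigenspaceAt (E j)) (hc : T.HasCompactResolvent) :
    T.opSpectrum = Set.range (fun j => (E j : ℂ)) := by
  refine Set.Subset.antisymm (fun w hw => ?_) (HilbertBasis.range_subset_opSpectrum he)
  by_contra hr
  obtain ⟨R, hR⟩ := hT.exists_isResolventAt (z := Complex.I) (by simp)
  have hne : ∀ j, (E j : ℂ) - Complex.I ≠ 0 := fun j h => by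
    simpa using congrArg Complex.im h
  have h1 := (hc.2 _ _ hR).tendsto_orthonormal_eigenvalues e.orthonormal
    fun j => hR.apply_eigenvector (he j) (sub_ne_zero.1 (hne j))
  refine hT.notMem_opSpectrum_of_finite he (fun j hj => hr ⟨j, hj⟩) one_pos ?_ hw
  -- If |E_j - w| < 1 then |E_j - i| < 2 + ‖w‖, so the resolvent eigenvalue at j exceeds this radius
  -- in modulus.
  have h2 := h1.eventually (Metric.ball_mem_nhds 0 (show 0 < (2 + ‖w‖)⁻¹ by positivity))
  rw [Filter.eventually_cofinite] at h2
  refine h2.subset fun j hj h3 => ?_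
  rw [dist_zero_right, norm_inv, inv_lt_inv₀ (norm_pos_iff.2 (hne j)) (by positivity)] at h3
  have h4 : ‖(E j : ℂ) - w‖ < 1 := hj
  have h5 := norm_add_le ((E j : ℂ) - w) (w - Complex.I)
  have h6 := norm_sub_le w Complex.I
  rw [sub_add_sub_cancel] at h5
  rw [Complex.norm_I] at h6
  linarith

theorem IsSelfAdjoint.opSpectrum_eq_insert (hT : IsSelfAdjoint T)
    (hK : ¬ FiniteDimensional ℂ K) (he : ∀ j, e j ∈ T.eigenspaceAt (E j)) {l : ℝ} {A : K →L[ℂ] K}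
    (hc : IsCompactOperator A)
    (hA : ∀ f : K, ∃ h : f ∈ T.domain, A f = (l : ℂ) • f - T ⟨f, h⟩) :
    T.opSpectrum = insert (l : ℂ) (Set.range (fun j => (E j : ℂ))) := by
  refine Set.Subset.antisymm (fun w hw => ?_)
    (Set.insert_subset ?_ (HilbertBasis.range_subset_opSpectrum he))
  · by_contra hr
    rw [Set.mem_insert_iff, not_or] at hr
    have h1 := hc.tendsto_orthonormal_eigenvalues e.orthonormal (s := fun j => (l : ℂ) - E j) fun j => by
      obtain ⟨h, h'⟩ := hA (e j)
      obtain ⟨h2, h2'⟩ := he j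
      rw [h', h2', sub_smul]
    have hpos : 0 < ‖w - l‖ / 2 := half_pos (norm_pos_iff.2 (sub_ne_zero.2 hr.1))
    refine hT.notMem_opSpectrum_of_finite he (fun j hj => hr.2 ⟨j, hj⟩) hpos ?_ hw
    have h2 := h1.eventually (Metric.ball_mem_nhds 0 hpos)
    rw [Filter.eventually_cofinite] at h2
    refine h2.subset fun j hj h3 => ?_
    rw [dist_zero_right] at h3
    have h4 : ‖(E j : ℂ) - w‖ < ‖w - l‖ / 2 := hj
    have h5 := norm_add_le ((E j : ℂ) - w) ((l : ℂ) - E j)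
    rw [← norm_neg, neg_add, neg_sub, neg_sub, sub_add_sub_cancel] at h5
    linarith
  · rintro ⟨R, hR⟩
    refine hK (FiniteDimensional.of_isCompactOperator_id (𝕜 := ℂ) ?_)
    -- If l were in the resolvent set, the identity would factor through the compact `A = l - T`,
    -- which is impossible in infinite dimension.
    have h1 : (id : K → K) = -(A ∘L R) := by
      funext g
      obtain ⟨h, h'⟩ := hR.1 g
      obtain ⟨h2, h2'⟩ := hA (R g)
      change g = -(A (R g))
      rw [h2', neg_sub, h']
    rw [h1]
    exact (hc.comp_clm R).neg

end DiagonalSpectrum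

/-! ### Assembly of the main theorem -/

theorem IsParsevalFrame.infinite {J K : Type*} [NormedAddCommGroup K] [InnerProductSpace ℂ K]
    {φ : J → K} (hφ : IsParsevalFrame φ) (hK : ¬ FiniteDimensional ℂ K) : Infinite J := by
  by_contra hfin
  rw [not_infinite_iff_finite] at hfin
  refine hK (Module.Finite.of_injective (LinearMap.pi fun j => (innerSL ℂ (φ j) : K →ₗ[ℂ] ℂ)) ?_)
  rw [injective_iff_map_eq_zero]
  exact fun f hf => hφ.eq_zero fun j => congrFun hf j

-- The function θ(x) = 2(x - l) / ((x - l)² + 1) is continuous and nonzero at μ, so energies near μ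
-- keep θ(E_j) away from zero. This isolates every eigenvalue other than l.
open Filter Topology in
theorem exists_finite_near_of_tendsto {J : Type*} {E : J → ℝ} {l μ : ℝ} (hμ : μ ≠ l)
    (h : Tendsto (fun j => ((2 * ((E j - l) / ((E j - l) ^ 2 + 1)) : ℝ) : ℂ)) cofinite (𝓝 0)) :
    ∃ ε > 0, {j | ‖(E j : ℂ) - μ‖ < ε}.Finite := by
  set θ : ℝ → ℝ := fun x => 2 * ((x - l) / ((x - l) ^ 2 + 1)) with hθ
  have hcont : Continuous θ := by
    have : ∀ x : ℝ, (x - l) ^ 2 + 1 ≠ 0 := fun x => by positivity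
    fun_prop (disch := exact this _)
  have hne : θ μ ≠ 0 :=
    mul_ne_zero two_ne_zero (div_ne_zero (sub_ne_zero.2 hμ) (by positivity))
  have hpos : 0 < |θ μ| / 2 := half_pos (abs_pos.2 hne)
  have h1 : ∀ᶠ x in 𝓝 μ, |θ μ| / 2 < |θ x| :=
    hcont.abs.continuousAt.eventually (lt_mem_nhds (half_lt_self (abs_pos.2 hne)))
  obtain ⟨ε, hε, h2⟩ := Metric.eventually_nhds_iff.1 h1
  refine ⟨ε, hε, ?_⟩
  have h3 := h.eventually (Metric.ball_mem_nhds 0 hpos)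
  rw [Filter.eventually_cofinite] at h3
  refine h3.subset fun j hj h4 => ?_
  rw [dist_zero_right, Complex.norm_real] at h4
  refine absurd h4 (h2 (y := E j) ?_).not_gt
  rw [dist_eq_norm, ← Complex.norm_real, Complex.ofReal_sub]
  exact hj

theorem theorem2p9
    {K : Type*} [NormedAddCommGroup K] [InnerProductSpace ℂ K] [CompleteSpace K]
    [TopologicalSpace.SeparableSpace K] (hK : ¬ FiniteDimensional ℂ K)
    {M : Type*} [NormedAddCommGroup M] [InnerProductSpace ℂ M] [CompleteSpace M]
    {J : Type*} [Countable J] [LinearOrder J] [LocallyFiniteOrder J]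
    (φ : J → K) (ψ : J → M) (hφψ : IsNaimarkComplement φ ψ)
    (E : J → ℝ) (hE : StrictMono E)
    (hJ : (∃ j₀ : J, ∀ j, j₀ ≤ j) ∨ (∃ j₀ : J, ∀ j, j ≤ j₀) ∨ ∀ C : ℝ, ∃ j, C < |E j|)
    (hH : IsSelfAdjoint (hamiltonian hφψ.parseval_left E))
    (hB : (frameOperator φ E hφψ.parseval_right).IsBounded) :
    ∃ (e : HilbertBasis J ℂ K) (E' : J → ℝ),
      hamiltonian hφψ.parseval_left E = hamiltonian e.isParsevalFrame E' ∧
      (hamiltonian hφψ.parseval_left E).discreteSpectrum = Set.range (fun j => (E' j : ℂ)) ∧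
      (Filter.Tendsto (fun j => |E j|) Filter.cofinite Filter.atTop →
        (hamiltonian hφψ.parseval_left E).HasCompactResolvent ∧
        (hamiltonian hφψ.parseval_left E).opSpectrum = Set.range (fun j => (E' j : ℂ))) ∧
      (∀ l : ℝ, Filter.Tendsto E Filter.cofinite (nhds l) →
        (∃ T : K →L[ℂ] K, IsCompactOperator T ∧
          ∀ f : K, ∃ h : f ∈ (hamiltonian hφψ.parseval_left E).domain,
            T f = (l : ℂ) • f - hamiltonian hφψ.parseval_left E ⟨f, h⟩) ∧
        (hamiltonian hφψ.parseval_left E).opSpectrum =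
          insert (l : ℂ) (Set.range (fun j => (E' j : ℂ)))) := by
  have hinf : Infinite J := hφψ.parseval_left.infinite hK
  set H := hamiltonian hφψ.parseval_left E with hHdef
  obtain ⟨l, hl, hθ⟩ : ∃ l : ℝ, H.eigenspaceAt l = ⊥ ∧
      Filter.Tendsto (fun j => (E j - l) / ((E j - l) ^ 2 + 1)) Filter.cofinite (nhds 0) := by
    rcases hE.exists_center hJ with h | ⟨l, h, h'⟩
    · obtain ⟨l, hl⟩ := hH.exists_eigenspaceAt_eq_bot
      exact ⟨l, hl, tendsto_div_sq_add_one_of_abs h⟩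
    · exact ⟨l, hφψ.eigenspaceAt_eq_bot h, h'⟩
  obtain ⟨R, hR⟩ := hH.exists_isResolventAt (z := l + Complex.I) (by simp)
  obtain ⟨R', hR'⟩ := hH.exists_isResolventAt (z := (starRingEnd ℂ) (l + Complex.I)) (by simp)
  have hc := hφψ.isCompactOperator_add_resolvent hH hB hθ hR hR'
  obtain ⟨e, E', he⟩ := hH.exists_hilbertBasis_eigenvectors hK (J := J) hl hR hR' hc
  refine ⟨e, E', hH.eq_hamiltonian he, ?_, fun hE => ?_, fun m hm => ?_⟩
  · refine hH.discreteSpectrum_eq_range he (fun j => IsSelfAdjoint.finiteDimensional_eigenspaceAt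
      hl hR hR' hc (E' j)) fun i => exists_finite_near_of_tendsto (l := l) ?_ ?_
    -- The only possible accumulation point `l` is not among the `E' i`, because its eigenspace is
    -- trivial.
    · intro h
      have h1 := he i
      rw [h, hl, Submodule.mem_bot] at h1
      exact e.orthonormal.ne_zero i h1
    · exact IsCompactOperator.tendsto_orthonormal_eigenvalues (S := R + R') hc e.orthonormal fun j =>
        LinearPMap.add_resolvent_apply_eigenvector hR hR' (he j)
  · have hcr := hφψ.hasCompactResolvent hH hB hE
    exact ⟨hcr, hH.opSpectrum_eq_range he hcr⟩
  · obtain ⟨A, hA, hA'⟩ := hφψ.exists_isCompactOperator_sub hm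
    exact ⟨⟨A, hA, hA'⟩, hH.opSpectrum_eq_insert hK he hA hA'⟩
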